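/- Consider full conjunctive queries without self-joins, $Q = R_1(\mathbb{A}_1) \bowtie \dots \bowtie R_m(\mathbb{A}_m)$ with $m \ge 1$, where each $\mathbb{A}_i$ is a finite set of attributes and each attribute $A$ has a nonempty, linearly ordered, possibly infinite domain $\Sigma^A$. A database $\mathcal{D}$ assigns to each $R_i$ a finite bag of tuples from $\Sigma^{\mathbb{A}_i}$; $n$ is the total number of tuples, and $Q(\mathcal{D})$ is the natural join under bag semantics. For a tuple $t\in\Sigma^{\mathbb{A}_i}$ of the domain of $R_i$ let $$TSens(t) = \max\bigl(|Q(\mathcal{D}\cup\{t\})\,\Delta\,Q(\mathcal{D})|,\ |Q(\mathcal{D})\,\Delta\,Q(\mathcal{D}\setminus\{t\})|\bigr),$$ where one copy of $t$ is added to, or removed from, $R_i$. The local sensitivity is $LS(Q,\mathcal{D}) = \max_t TSens(t)$, over all tuples of the domains of all $m$ relations. $Q$ is acyclic if repeatedly removing ears (GYO decomposition) empties the hypergraph with hyperedges $\mathbb{A}_1,\dots,\mathbb{A}_m$; here $h$ is an ear if those of its vertices that belong to other remaining hyperedges are all contained in a single other one, $h'$. A join tree of $Q$ is a rooted tree whose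 nodes are $R_1,\dots,R_m$ such that $\mathbb{A}_i\cap\mathbb{A}_j$ is contained in every relation on the path from $R_i$ to $R_j$. Algorithm LSAcyclicJoin takes a join tree $\mathcal{T}$ of $Q$ and $\mathcal{D}$. All tables carry a column of counts; $\widetilde{\bowtie}$ is the natural join multiplying counts, performed table by table with sort-merge joins (the join of no tables is the table whose only row is the empty tuple, with count $1$), and $\gamma_{\mathbb{A}}$ groups by those attributes of $\mathbb{A}$ that the table has, adding counts, by sorting. With $p(R_i)$ the parent and $C(R_i)$ the children of $R_i$, it computes 1. in post-order, the botjoins $\bot(R_i) = \gamma_{\mathbb{A}_i\cap\mathbb{A}_{p(R_i)}}\widetilde{\bowtie}(R_i,\{\bot(R_j) : R_j\in C(R_i)\})$ (grouping by $\mathbb{A}_i$ at the root); 2. in pre-order, for $R_i$ other than the root, the topjoins $\top(R_i) = \gamma_{\mathbb{A}_i\cap\mathbb{A}_{p(R_i)}}\widetilde{\bowtie}(p(R_i),\top(p(R_i)),\{\bot(R_j) : R_j \in C(p(R_i))\setminus\{R_i\}\})$, where $\top(p(R_i))$ is omitted if $p(R_i)$ is the root; 3. the multiplicity tables $T^i =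 \gamma_{\mathbb{A}_i}\widetilde{\bowtie}(\top(R_i),\{\bot(R_j) : R_j\in C(R_i)\})$, where $\top(R_i)$ is omitted at the root; 4. a row with the largest count in all the $T^i$; it returns this count and this row $t^*$ as a tuple of $R_i$, with an arbitrary value at attributes that occur in no other relation (if all $T^i$ are empty, it returns $0$ and an arbitrary tuple). Then the following holds. Every acyclic $Q$ has a tree recorded by a GYO decomposition (an eliminated ear hangs below a remaining hyperedge containing all its vertices that are shared with remaining hyperedges), and every such tree is a join tree. For every query $Q$, every join tree $\mathcal{T}$ of $Q$ and every database $\mathcal{D}$, LSAcyclicJoin returns $LS(Q,\mathcal{D})$ (in particular the maximum exists) and a most sensitive tuple $t^*$, i.e. $TSens(t^*) = LS(Q,\mathcal{D})$. Moreover, there is an absolute constant $c$ such that, if $m\ge 2$ and $n\ge 2$, the running time is at most $c\, m\, d\, n^{d} \log n$, where $d$ is the maximum degree of $\mathcal{T}$ (number of children, plus one for the parent at non-root nodes). Running time is the number of elementary steps, where reading, comparing, projecting or combining tuples, arithmetic on counts and operations on attribute sets have unit cost. -/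

import Mathlib

universe u v w

noncomputable section

namespace LSJoin

/-! ## Queries, tuples, bag semantics and sensitivity -/

/-- A full conjunctive query `R_1(𝔸_1), …, R_m(𝔸_m)` without self-joins, over attributes named by
`Fin k`: relation symbol `i` occurs exactly once and has the attribute set `Q i`. -/
abbrev Query (k m : ℕ) := Fin m → Finset (Fin k)

/-- Tuples over the attribute set `S`: the elements of `Σ^S = ∏_{a ∈ S} Σ^a`. -/
def Tuple {k : ℕ} (Dom : Fin k → Type u) (S : Finset (Fin k)) : Type u :=
  ∀ a : {a // a ∈ S}, Dom a

section Semantics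

variable {k m : ℕ} {Dom : Fin k → Type u}

/-- The restriction `t.S'` of a tuple to a smaller attribute set. -/
def Tuple.restrict {S S' : Finset (Fin k)} (h : S' ⊆ S) (t : Tuple Dom S) : Tuple Dom S' :=
  fun a => t ⟨a, h a.2⟩

/-- Two tuples put together (used when they agree on the common attributes). -/
def Tuple.glue {S S' : Finset (Fin k)} (t : Tuple Dom S) (t' : Tuple Dom S') :
    Tuple Dom (S ∪ S') :=
  fun a => if h : (a : Fin k) ∈ S then t ⟨a, h⟩
    else t' ⟨a, (Finset.mem_union.1 a.2).resolve_left h⟩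

/-- The tuple over `S'` that agrees with `t` where `t` is defined and takes an arbitrary (default)
value at the remaining attributes. -/
def Tuple.extrapolate [∀ a, Inhabited (Dom a)] {S : Finset (Fin k)} (t : Tuple Dom S)
    (S' : Finset (Fin k)) : Tuple Dom S' :=
  fun a => if h : (a : Fin k) ∈ S then t ⟨a, h⟩ else default

/-- Tuples are compared lexicographically. -/
instance [∀ a, LinearOrder (Dom a)] (S : Finset (Fin k)) : LinearOrder (Tuple Dom S) :=
  inferInstanceAs (LinearOrder (Lex (∀ a : {a // a ∈ S}, Dom a)))

/-- A database instance: every relation is a bag of tuples. -/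
abbrev Instance (Q : Query k m) (Dom : Fin k → Type u) := ∀ i, Multiset (Tuple Dom (Q i))

/-- The attributes `𝔸_D = ⋃ 𝔸_i` of the query. -/
def Query.attrs (Q : Query k m) : Finset (Fin k) := Finset.univ.biUnion Q

variable [∀ a, LinearOrder (Dom a)] {Q : Query k m}

/-- One row (counted with multiplicity) has been chosen from every relation; the chosen rows agree
on all common attributes. -/
def Compatible {D : Instance Q Dom} (f : ∀ i, (D i).ToType) : Prop :=
  ∀ (i j : Fin m) (a : Fin k) (hi : a ∈ Q i) (hj : a ∈ Q j), (f i).1 ⟨a, hi⟩ = (f j).1 ⟨a, hj⟩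

/-- The output row of a compatible choice of rows. -/
def outputRow {D : Instance Q Dom} (f : ∀ i, (D i).ToType) : Tuple Dom Q.attrs :=
  fun a =>
    let h : ∃ i, (a : Fin k) ∈ Q i := by simpa [Query.attrs] using a.2
    (f h.choose).1 ⟨a, h.choose_spec⟩

open Classical in
/-- The query result `Q(D)`: the natural join of all relations under bag semantics. -/
def answer (D : Instance Q Dom) : Multiset (Tuple Dom Q.attrs) :=
  (Finset.univ.filter fun f : ∀ i, (D i).ToType => Compatible f).val.map outputRow

/-- `D ∪ {t}`: one copy of `t` is added to relation `i`. -/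
def insertTuple (D : Instance Q Dom) (i : Fin m) (t : Tuple Dom (Q i)) : Instance Q Dom :=
  Function.update D i (t ::ₘ D i)

/-- `D \ {t}`: one copy of `t` is removed from relation `i` (nothing happens if there is none). -/
def deleteTuple (D : Instance Q Dom) (i : Fin m) (t : Tuple Dom (Q i)) : Instance Q Dom :=
  Function.update D i ((D i).erase t)

/-- The symmetric difference of two bags. -/
def bagSymmDiff {α : Type u} [DecidableEq α] (s t : Multiset α) : Multiset α := (s - t) ∪ (t - s)

/-- Upward tuple sensitivity. -/
def upSens (D : Instance Q Dom) (t : Σ i, Tuple Dom (Q i)) : ℕ :=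
  (bagSymmDiff (answer (insertTuple D t.1 t.2)) (answer D)).card

/-- Downward tuple sensitivity. -/
def downSens (D : Instance Q Dom) (t : Σ i, Tuple Dom (Q i)) : ℕ :=
  (bagSymmDiff (answer D) (answer (deleteTuple D t.1 t.2))).card

/-- Tuple sensitivity. -/
def tupleSens (D : Instance Q Dom) (t : Σ i, Tuple Dom (Q i)) : ℕ :=
  max (upSens D t) (downSens D t)

/-- `s` is the local sensitivity: the maximum of the tuple sensitivities over all tuples from the
(possibly infinite) domains of all relations. -/
def IsLocalSensitivity (D : Instance Q Dom) (s : ℕ) : Prop :=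
  IsGreatest (Set.range (tupleSens D)) s

end Semantics

/-! ## Rooted trees, GYO decomposition, join trees -/

/-- Finite rooted trees with labelled nodes. -/
inductive RTree (α : Type v) : Type v
  | node : α → List (RTree α) → RTree α

namespace RTree

variable {α : Type v}

/-- The label of the root. -/
def label : RTree α → α
  | node a _ => a

mutual
/-- The labels of all nodes. -/
def nodes : RTree α → List α
  | node a cs => a :: nodesList cs
/-- The labels of all nodes of a list of trees. -/
def nodesList : List (RTree α) → List α
  | [] => []
  | c :: cs => nodes c ++ nodesList cs
end

mutual
/-- All pairs (parent, child). -/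
def edges : RTree α → List (α × α)
  | node a cs => edgesList a cs
/-- All pairs (parent, child), for a list of trees below `a`. -/
def edgesList (a : α) : List (RTree α) → List (α × α)
  | [] => []
  | c :: cs => (a, c.label) :: (edges c ++ edgesList a cs)
end

/-- The underlying undirected graph. -/
def graph (T : RTree α) : SimpleGraph α :=
  SimpleGraph.fromRel fun a b => (a, b) ∈ T.edges

mutual
/-- The maximal degree within a tree whose root has `e` further edges. -/
def maxDegreeAux (e : ℕ) : RTree α → ℕ
  | node _ cs => max (cs.length + e) (maxDegreeList cs)
/-- The maximal degree of the nodes of a list of trees whose roots all have a parent. -/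
def maxDegreeList : List (RTree α) → ℕ
  | [] => 0
  | c :: cs => max (maxDegreeAux 1 c) (maxDegreeList cs)
end

/-- The maximal degree of the tree: the number of children, plus one (for the parent) at every node
other than the root. -/
def maxDegree (T : RTree α) : ℕ := maxDegreeAux 0 T

mutual
/-- Add a new leaf `i` as a child of the node `j`. -/
def attach [DecidableEq α] (j i : α) : RTree α → RTree α
  | node a cs => node a (if a = j then node i [] :: attachList j i cs else attachList j i cs)
/-- Add a new leaf `i` as a child of the node `j` in a list of trees. -/
def attachList [DecidableEq α] (j i : α) : List (RTree α) → List (RTree α)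
  | [] => []
  | c :: cs => attach j i c :: attachList j i cs
end

end RTree

section Acyclic

variable {k m : ℕ}

/-- Hyperedge `i` is an ear of the hypergraph with hyperedges `H`: each of its vertices belongs to
no other hyperedge, or those that do are all contained in one other hyperedge `j`. -/
def IsEar (Q : Query k m) (H : Finset (Fin m)) (i : Fin m) : Prop :=
  i ∈ H ∧ ((∀ a ∈ Q i, ∀ l ∈ H, l ≠ i → a ∉ Q l) ∨
    ∃ j ∈ H, j ≠ i ∧ ∀ a ∈ Q i, (∀ l ∈ H, l ≠ i → a ∉ Q l) ∨ a ∈ Q j)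

/-- Repeatedly removing ears can empty the hypergraph with hyperedges `H`. -/
inductive GYOReduces (Q : Query k m) : Finset (Fin m) → Prop
  | empty : GYOReduces Q ∅
  | ear {H : Finset (Fin m)} {i : Fin m} :
      IsEar Q H i → GYOReduces Q (H.erase i) → GYOReduces Q H

/-- Acyclic queries: the GYO decomposition ends with the empty hypergraph. -/
def Query.IsAcyclic (Q : Query k m) : Prop := GYOReduces Q Finset.univ

/-- `T` is a rooted tree recorded by a GYO decomposition of the hypergraph with hyperedges `H`: the
hyperedge that is eliminated last is the root, and whenever `i` is eliminated as an ear, it hangs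
below a remaining `j` that contains all vertices of `i` shared with remaining hyperedges. (If there
are none, as happens for disconnected hypergraphs, `i` may hang below any remaining `j`.) -/
inductive GYOTree (Q : Query k m) : Finset (Fin m) → RTree (Fin m) → Prop
  | last (i : Fin m) : GYOTree Q {i} (RTree.node i [])
  | ear {H : Finset (Fin m)} {T : RTree (Fin m)} {i j : Fin m} :
      GYOTree Q H T → i ∉ H → j ∈ H → (∀ a ∈ Q i, (∀ l ∈ H, a ∉ Q l) ∨ a ∈ Q j) →
      GYOTree Q (insert i H) (T.attach j i)

/-- `T` is a (rooted) join tree of `Q`: its nodes are the relations of `Q`, each once, and the common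
attributes of two relations `i`, `j` belong to all relations on the path from `i` to `j` (which is
unique, the graph being a tree). -/
structure IsJoinTree (Q : Query k m) (T : RTree (Fin m)) : Prop where
  nodes_perm : T.nodes.Perm (List.finRange m)
  path : ∀ i j : Fin m, ∃ p : T.graph.Walk i j, p.IsPath ∧ ∀ l ∈ p.support, Q i ∩ Q j ⊆ Q l

end Acyclic

/-! ## Computations with a step count

A step is one case of a recursive procedure together with a bounded number of basic operations:
reading, comparing, restricting or gluing tuples, adding or multiplying counts, operations on
attribute sets, building list cells or tree nodes. -/

/-- A value together with the number of steps that were spent on it. -/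
structure Timed (α : Type u) : Type u where
  val : α
  cost : ℕ

instance : Monad Timed.{u} where
  pure a := ⟨a, 0⟩
  bind x f := ⟨(f x.val).val, x.cost + (f x.val).cost⟩

/-- Spend one step. -/
def Timed.step {α : Type u} (c : Timed α) : Timed α := ⟨c.val, c.cost + 1⟩

/-- Spend `s` further steps. -/
def Timed.spend {α : Type u} (s : ℕ) (c : Timed α) : Timed α := ⟨c.val, c.cost + s⟩

open Timed

section Lists

variable {α : Type u} {β : Type u} {γ : Type u} {κ : Type w}

/-- `List.map`, one step per element. -/
def mapT {α : Type v} {β : Type u} (f : α → β) : List α → Timed (List β)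
  | [] => step (pure [])
  | a :: l => step do
      let l' ← mapT f l
      pure (f a :: l')

/-- `l₁.reverse ++ l₂`. -/
def revAppendT : List α → List α → Timed (List α)
  | [], l₂ => step (pure l₂)
  | a :: l₁, l₂ => step (revAppendT l₁ (a :: l₂))

/-- Deal the elements of a list alternately to two lists. -/
def splitT : List α → Timed (List α × List α)
  | [] => step (pure ([], []))
  | a :: l => step do
      let p ← splitT l
      pure (a :: p.2, p.1)

theorem splitT_length (l : List α) :
    (splitT l).val.1.length = (l.length + 1) / 2 ∧ (splitT l).val.2.length = l.length / 2 := by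
  induction l with
  | nil => simp [splitT, step, pure]
  | cons a l ih =>
    have h1 : (splitT (a :: l)).val = (a :: (splitT l).val.2, (splitT l).val.1) := rfl
    rw [h1]
    simp only [List.length_cons]
    omega

/-- Merge two lists that are sorted by `key`. -/
def mergeT [LinearOrder κ] (key : α → κ) : List α → List α → Timed (List α)
  | [], l₂ => step (pure l₂)
  | a :: l₁, [] => step (pure (a :: l₁))
  | a :: l₁, b :: l₂ => step (
      if key a ≤ key b then do
        let l ← mergeT key l₁ (b :: l₂)
        pure (a :: l)
      else do
        let l ← mergeT key (a :: l₁) l₂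
        pure (b :: l))
termination_by l₁ l₂ => l₁.length + l₂.length

/-- Merge sort by `key`. -/
def sortT [LinearOrder κ] (key : α → κ) : List α → Timed (List α)
  | [] => step (pure [])
  | [a] => step (pure [a])
  | a :: b :: l =>
      let p := splitT (a :: b :: l)
      step (spend p.cost do
        let l₁ ← sortT key p.val.1
        let l₂ ← sortT key p.val.2
        mergeT key l₁ l₂)
termination_by l => l.length
decreasing_by
  all_goals
    have h := splitT_length (a :: b :: l)
    simp only [List.length_cons] at h ⊢
    omega

/-- Put `f b` in front of `rest`, for all `b` in the initial block with key `c`. -/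
def emitBlock [LinearOrder κ] (key : β → κ) (c : κ) (f : β → γ) (rest : List γ) :
    List β → Timed (List γ)
  | [] => step (pure rest)
  | b :: l => step (
      if key b = c then do
        let out ← emitBlock key c f rest l
        pure (f b :: out)
      else pure rest)

/-- The merge phase of a sort-merge join of two lists sorted by their keys: all `f a b` for which
the keys of `a` and `b` coincide. -/
def mergeJoin [LinearOrder κ] (key₁ : α → κ) (key₂ : β → κ) (f : α → β → γ) :
    List α → List β → Timed (List γ)
  | [], _ => step (pure [])
  | _ :: _, [] => step (pure [])
  | a :: l₁, b :: l₂ => step (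
      if key₁ a < key₂ b then mergeJoin key₁ key₂ f l₁ (b :: l₂)
      else if key₂ b < key₁ a then mergeJoin key₁ key₂ f (a :: l₁) l₂
      else do
        let rest ← mergeJoin key₁ key₂ f l₁ (b :: l₂)
        emitBlock key₂ (key₁ a) (f a) rest (b :: l₂))
termination_by l₁ l₂ => l₁.length + l₂.length

/-- Collapse each block of consecutive rows with equal tuples, starting with the row `r`, to one
row; the counts are added. -/
def collapseFrom [LinearOrder α] (r : α × ℕ) : List (α × ℕ) → Timed (List (α × ℕ))
  | [] => step (pure [r])
  | s :: l => step (
      if s.1 = r.1 then collapseFrom (r.1, r.2 + s.2) l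
      else do
        let out ← collapseFrom s l
        pure (r :: out))

/-- Collapse each block of consecutive rows with equal tuples to one row, adding the counts. -/
def collapse [LinearOrder α] : List (α × ℕ) → Timed (List (α × ℕ))
  | [] => step (pure [])
  | r :: l => step (collapseFrom r l)

end Lists

/-! ## The algorithm -/

/-- A table with a multiplicity column `cnt`. -/
structure Table {k : ℕ} (Dom : Fin k → Type u) : Type u where
  schema : Finset (Fin k)
  rows : List (Tuple Dom schema × ℕ)

section Algorithm

variable {k m : ℕ} {Dom : Fin k → Type u} [∀ a, LinearOrder (Dom a)]

/-- Group by the attributes in `S` and add the counts, by sorting. -/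
def groupBy (S : Finset (Fin k)) (R : Table Dom) : Timed (Table Dom) := step do
  let keyed ← mapT (fun r : Tuple Dom R.schema × ℕ =>
    (r.1.restrict (Finset.inter_subset_right (s₁ := S)), r.2)) R.rows
  let sorted ← sortT (fun r : Tuple Dom (S ∩ R.schema) × ℕ => r.1) keyed
  let rows ← collapse sorted
  pure ⟨S ∩ R.schema, rows⟩

/-- The natural join of two tables, with the product of the counts, by sort-merge. -/
def join (R R' : Table Dom) : Timed (Table Dom) := step do
  let key : Tuple Dom R.schema × ℕ → Tuple Dom (R.schema ∩ R'.schema) :=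
    fun r => r.1.restrict Finset.inter_subset_left
  let key' : Tuple Dom R'.schema × ℕ → Tuple Dom (R.schema ∩ R'.schema) :=
    fun r => r.1.restrict Finset.inter_subset_right
  let l ← sortT key R.rows
  let l' ← sortT key' R'.rows
  let rows ← mergeJoin key key' (fun r r' => (r.1.glue r'.1, r.2 * r'.2)) l l'
  pure ⟨R.schema ∪ R'.schema, rows⟩

/-- Join a table with the tables of a list, one by one. -/
def joinFrom (R : Table Dom) : List (Table Dom) → Timed (Table Dom)
  | [] => step (pure R)
  | R' :: l => step do
      let J ← join R R'
      joinFrom J l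

/-- Join the tables of a list, one by one; the empty join has one row, the empty tuple. -/
def joinAll : List (Table Dom) → Timed (Table Dom)
  | [] => step (pure ⟨∅, [(fun a => absurd a.2 (Finset.notMem_empty _), 1)]⟩)
  | R :: l => step (joinFrom R l)

/-- A database as it is stored: every relation is a list of tuples, in any order and possibly with
repetitions. -/
abbrev Database (Q : Query k m) (Dom : Fin k → Type u) := ∀ i, List (Tuple Dom (Q i))

/-- The instance (a bag for each relation) that is stored in a database. -/
def Database.toInstance {Q : Query k m} (D : Database Q Dom) : Instance Q Dom :=
  fun i => (D i : Multiset (Tuple Dom (Q i)))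

/-- The total number `n` of tuples. -/
def Database.size {Q : Query k m} (D : Database Q Dom) : ℕ := ∑ i, (D i).length

/-- A relation with the additional column `cnt` that records the multiplicity of its tuples. -/
def countTable {Q : Query k m} (D : Database Q Dom) (i : Fin m) : Timed (Table Dom) := step do
  let rows ← mapT (fun t => (t, 1)) (D i)
  groupBy (Q i) ⟨Q i, rows⟩

/-- What is stored at a node of the join tree after the first pass: the relation's index, the
relation with counts, and its botjoin. -/
structure BotInfo (m : ℕ) (Dom : Fin k → Type u) : Type u where
  idx : Fin m
  rel : Table Dom
  bot : Table Dom

/-- What is stored at a node of the join tree after the second pass; the topjoin is absent at the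
root. -/
structure TopInfo (m : ℕ) (Dom : Fin k → Type u) extends BotInfo m Dom where
  top : Option (Table Dom)

mutual
/-- I) The botjoins in post-order: `⊥(R_i) = γ_{𝔸_i ∩ P} ⋈(R_i, {⊥(R_j) : R_j child of R_i})`,
where `P` is the attribute set of the parent (and of `R_i` itself, if `R_i` is the root). -/
def botPass {Q : Query k m} (D : Database Q Dom) (P : Finset (Fin k)) :
    RTree (Fin m) → Timed (RTree (BotInfo m Dom))
  | .node i cs => step do
      let R ← countTable D i
      let cs' ← botPassList D (Q i) cs
      let bots ← mapT (fun c => c.label.bot) cs'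
      let J ← joinFrom R bots
      let b ← groupBy (Q i ∩ P) J
      pure (.node ⟨i, R, b⟩ cs')
/-- The botjoins in a list of trees. -/
def botPassList {Q : Query k m} (D : Database Q Dom) (P : Finset (Fin k)) :
    List (RTree (Fin m)) → Timed (List (RTree (BotInfo m Dom)))
  | [] => step (pure [])
  | c :: cs => step do
      let c' ← botPass D P c
      let cs' ← botPassList D P cs
      pure (c' :: cs')
end

mutual
/-- II) The topjoins in pre-order, in a tree whose root has the topjoin `top`. -/
def topPass (Q : Query k m) (top : Option (Table Dom)) :
    RTree (BotInfo m Dom) → Timed (RTree (TopInfo m Dom))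
  | .node v cs => step do
      let cs' ← topPassList Q v top [] cs
      pure (.node ⟨v, top⟩ cs')
/-- The topjoins in the list of the remaining trees below the node `p`, where `left` are the
botjoins of the preceding children:
`⊤(R_i) = γ_{𝔸_i ∩ 𝔸_p} ⋈(R_p, ⊤(R_p), {⊥(R_j) : R_j sibling of R_i})`. -/
def topPassList (Q : Query k m) (p : BotInfo m Dom) (top : Option (Table Dom))
    (left : List (Table Dom)) :
    List (RTree (BotInfo m Dom)) → Timed (List (RTree (TopInfo m Dom)))
  | [] => step (pure [])
  | c :: cs => step do
      let right ← mapT (fun c' => c'.label.bot) cs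
      let siblings ← revAppendT left right
      let J ← joinFrom p.rel (top.toList ++ siblings)
      let t ← groupBy (Q c.label.idx ∩ Q p.idx) J
      let c' ← topPass Q (some t) c
      let cs' ← topPassList Q p top (c.label.bot :: left) cs
      pure (c' :: cs')
end

mutual
/-- III) The multiplicity tables `T^i = γ_{𝔸_i} ⋈(⊤(R_i), {⊥(R_j) : R_j child of R_i})`, put in front
of the list `acc`. -/
def multPass (Q : Query k m) (acc : List (Fin m × Table Dom)) :
    RTree (TopInfo m Dom) → Timed (List (Fin m × Table Dom))
  | .node v cs => step do
      let bots ← mapT (fun c => c.label.bot) cs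
      let J ← joinAll (v.top.toList ++ bots)
      let M ← groupBy (Q v.idx) J
      let acc' ← multPassList Q acc cs
      pure ((v.idx, M) :: acc')
/-- The multiplicity tables of a list of trees. -/
def multPassList (Q : Query k m) (acc : List (Fin m × Table Dom)) :
    List (RTree (TopInfo m Dom)) → Timed (List (Fin m × Table Dom))
  | [] => step (pure acc)
  | c :: cs => step do
      let acc' ← multPassList Q acc cs
      multPass Q acc' c
end

/-- The output: a count, and a tuple from the domain of one of the relations. -/
structure Output (Q : Query k m) (Dom : Fin k → Type u) : Type u where
  sens : ℕ
  tuple : Σ i, Tuple Dom (Q i)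

variable [∀ a, Inhabited (Dom a)]

/-- IV) The row with the largest count among `best` and the rows of `T^i`. Attributes that occur in
no other relation get an arbitrary value. -/
def bestRow {Q : Query k m} (i : Fin m) {S : Finset (Fin k)} (best : Output Q Dom) :
    List (Tuple Dom S × ℕ) → Timed (Output Q Dom)
  | [] => step (pure best)
  | r :: l => step (
      bestRow i (if best.sens < r.2 then ⟨r.2, ⟨i, r.1.extrapolate (Q i)⟩⟩ else best) l)

/-- The row with the largest count among `best` and the rows of a list of multiplicity tables. -/
def bestTable {Q : Query k m} (best : Output Q Dom) :
    List (Fin m × Table Dom) → Timed (Output Q Dom)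
  | [] => step (pure best)
  | p :: l => step do
      let best' ← bestRow p.1 best p.2.rows
      bestTable best' l

/-- The algorithm, on a join tree of the query and a database. If all multiplicity tables are
empty, it returns the count `0` and an arbitrary tuple. -/
def lsAcyclicJoin (Q : Query k m) (T : RTree (Fin m)) (D : Database Q Dom) :
    Timed (Output Q Dom) := step do
  let T₁ ← botPass D (Q T.label) T
  let T₂ ← topPass Q none T₁
  let tables ← multPass Q [] T₂
  bestTable ⟨0, ⟨T.label, fun _ => default⟩⟩ tables

end Algorithm

end LSJoin

end

-- The multiplicity of a row in the natural join is the product of the multiplicities of its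
-- restrictions (`count_answer`), hence linear in each single relation. Inserting `t` into relation
-- `i` therefore changes an output row extending `t` by the product over the other relations, and
-- deletion changes it by no more. So the sensitivity of `t` is the sum, over assignments extending
-- `t`, of the product of the multiplicities in all relations but `i` (`tupleSens_eq_message`). Only
-- values of the finite active domain contribute, which is why a maximum exists even over infinite
-- domains.
--
-- A table is viewed as a weight function on total assignments: joining multiplies weights
-- (`join_weight`), grouping sums attributes out (`groupBy_weight`). For a set `X` of relations,
-- `message S X` is the product of their weights with all attributes outside `S` summed out. Two
-- identities drive the correctness proof: messages of parts that share attributes only within `S`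
-- multiply (`prod_message`), and joining relation `i` with the message of `X` and summing out gives
-- the message of `insert i X` (`marg_mul_message`). In a join tree every walk out of a child's
-- subtree uses the edge to its parent, so the separation conditions hold
-- (`runningIntersection_of_graph`). Hence a botjoin is the message of a subtree (`bot_represents`),
-- a topjoin that of the complement (`childTop_topInput`), and the multiplicity table of `i` carries
-- exactly the sensitivities of its tuples (`tupleSens_eq_weight`). Its rows are distinct, so the
-- largest count is the local sensitivity.
--
-- For the running time, the first two passes join a relation with tables of distinct rows and no
-- new attributes, so no intermediate table exceeds `n` rows (`join_length_le`). Only in the third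
-- pass, where no relation anchors the join, can up to `d` tables multiply to `n ^ d` rows; there
-- the costs grow geometrically and the last join dominates (`joinFrom_cost_le_pow`).

namespace LSJoin

-- Values and costs of timed computations

namespace Timed

variable {α β : Type u}

@[simp] theorem val_pure (a : α) : (pure a : Timed α).val = a := rfl
@[simp] theorem cost_pure (a : α) : (pure a : Timed α).cost = 0 := rfl
@[simp] theorem val_bind (x : Timed α) (f : α → Timed β) : (x >>= f).val = (f x.val).val := rfl
@[simp] theorem cost_bind (x : Timed α) (f : α → Timed β) :
    (x >>= f).cost = x.cost + (f x.val).cost := rfl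
@[simp] theorem val_step (x : Timed α) : x.step.val = x.val := rfl
@[simp] theorem cost_step (x : Timed α) : x.step.cost = x.cost + 1 := rfl
@[simp] theorem cost_spend (s : ℕ) (x : Timed α) : (x.spend s).cost = x.cost + s := rfl

end Timed

-- List procedures: sorting, merging, collapsing

section Lists

variable {α : Type u} {β : Type u} {γ : Type u} {κ : Type w}

@[simp] theorem mapT_val {α : Type v} {β : Type u} (f : α → β) (l : List α) :
    (mapT f l).val = l.map f := by
  induction l with
  | nil => rfl
  | cons a l ih => simp [mapT, ih]

@[simp] theorem mapT_cost {α : Type v} {β : Type u} (f : α → β) (l : List α) :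
    (mapT f l).cost = l.length + 1 := by
  induction l with
  | nil => rfl
  | cons a l ih => simp [mapT, ih]

@[simp] theorem revAppendT_val (l₁ l₂ : List α) :
    (revAppendT l₁ l₂).val = l₁.reverse ++ l₂ := by
  induction l₁ generalizing l₂ with
  | nil => rfl
  | cons a l ih => simp [revAppendT, ih]

@[simp] theorem revAppendT_cost (l₁ l₂ : List α) :
    (revAppendT l₁ l₂).cost = l₁.length + 1 := by
  induction l₁ generalizing l₂ with
  | nil => rfl
  | cons a l ih => simp [revAppendT, ih]

theorem splitT_cost (l : List α) : (splitT l).cost = l.length + 1 := by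
  induction l with
  | nil => rfl
  | cons a l ih => simp [splitT, ih]

theorem splitT_perm (l : List α) : ((splitT l).val.1 ++ (splitT l).val.2).Perm l := by
  induction l with
  | nil => exact List.Perm.refl _
  | cons a l ih =>
    simp only [splitT, Timed.val_step, Timed.val_bind, Timed.val_pure, List.cons_append]
    exact (List.perm_append_comm.trans ih).cons a

theorem mergeT_perm [LinearOrder κ] (key : α → κ) (l₁ l₂ : List α) :
    (mergeT key l₁ l₂).val.Perm (l₁ ++ l₂) := by
  induction l₁, l₂ using mergeT.induct with
  | case1 l₂ => simp [mergeT]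
  | case2 a l₁ => simp [mergeT]
  | case3 a l₁ b l₂ ih ih' =>
    by_cases h : key a ≤ key b
    · simpa [mergeT, h] using ih
    · simp only [mergeT, h, if_false, Timed.val_step, Timed.val_bind, Timed.val_pure]
      exact (ih'.cons b).trans List.perm_middle.symm

theorem mergeT_sorted [LinearOrder κ] (key : α → κ) (l₁ l₂ : List α)
    (h₁ : l₁.Pairwise fun a b => key a ≤ key b) (h₂ : l₂.Pairwise fun a b => key a ≤ key b) :
    (mergeT key l₁ l₂).val.Pairwise fun a b => key a ≤ key b := by
  induction l₁, l₂ using mergeT.induct with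
  | case1 l₂ => simpa [mergeT] using h₂
  | case2 a l₁ => simpa [mergeT] using h₁
  | case3 a l₁ b l₂ ih ih' =>
    by_cases h : key a ≤ key b
    · simp only [mergeT, h, if_true, Timed.val_step, Timed.val_bind, Timed.val_pure]
      rw [List.pairwise_cons] at h₁ ⊢
      refine ⟨fun x hx => ?_, ih h₁.2 h₂⟩
      rcases List.mem_append.1 ((mergeT_perm key _ _).mem_iff.1 hx) with hx | hx
      · exact h₁.1 x hx
      · rcases List.mem_cons.1 hx with rfl | hx
        · exact h
        · exact h.trans ((List.pairwise_cons.1 h₂).1 x hx)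
    · simp only [mergeT, h, if_false, Timed.val_step, Timed.val_bind, Timed.val_pure]
      rw [List.pairwise_cons] at h₂ ⊢
      refine ⟨fun x hx => ?_, ih' h₁ h₂.2⟩
      rcases List.mem_append.1 ((mergeT_perm key _ _).mem_iff.1 hx) with hx | hx
      · rcases List.mem_cons.1 hx with rfl | hx
        · exact (not_le.1 h).le
        · exact (not_le.1 h).le.trans ((List.pairwise_cons.1 h₁).1 x hx)
      · exact h₂.1 x hx

theorem mergeT_cost_le [LinearOrder κ] (key : α → κ) (l₁ l₂ : List α) :
    (mergeT key l₁ l₂).cost ≤ l₁.length + l₂.length + 1 := by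
  induction l₁, l₂ using mergeT.induct with
  | case1 l₂ => simp [mergeT]
  | case2 a l₁ => simp [mergeT]
  | case3 a l₁ b l₂ ih ih' =>
    by_cases h : key a ≤ key b
    · simp only [mergeT, h, if_true, Timed.cost_step, Timed.cost_bind, Timed.cost_pure,
        List.length_cons] at ih ⊢
      omega
    · simp only [mergeT, h, if_false, Timed.cost_step, Timed.cost_bind, Timed.cost_pure,
        List.length_cons] at ih' ⊢
      omega

theorem sortT_perm [LinearOrder κ] (key : α → κ) (l : List α) : (sortT key l).val.Perm l := by
  induction l using sortT.induct with
  | case1 => simp [sortT]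
  | case2 a => simp [sortT]
  | case3 a b l p ih₁ ih₂ =>
    rw [sortT]
    exact (mergeT_perm key _ _).trans ((ih₁.append ih₂).trans (splitT_perm _))

theorem sortT_sorted [LinearOrder κ] (key : α → κ) (l : List α) :
    (sortT key l).val.Pairwise fun a b => key a ≤ key b := by
  induction l using sortT.induct with
  | case1 => simp [sortT]
  | case2 a => simp [sortT]
  | case3 a b l p ih₁ ih₂ =>
    rw [sortT]
    exact mergeT_sorted key _ _ ih₁ ih₂

@[simp] theorem sortT_length [LinearOrder κ] (key : α → κ) (l : List α) :
    (sortT key l).val.length = l.length := (sortT_perm key l).length_eq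

/-- Merge sort takes `O(ℓ log ℓ)` steps. -/
theorem sortT_cost_le [LinearOrder κ] (key : α → κ) (l : List α) (e : ℕ)
    (h : l.length ≤ 2 ^ e) : (sortT key l).cost ≤ 4 * l.length * e + l.length + 1 := by
  induction l using sortT.induct generalizing e with
  | case1 => simp [sortT]
  | case2 a => simp [sortT]
  | case3 a b l p ih₁ ih₂ =>
    have hl := splitT_length (a :: b :: l)
    have hc := splitT_cost (a :: b :: l)
    -- At least two elements force a positive exponent, and both halves have length at most `2 ^ e`.
    obtain ⟨e, rfl⟩ : ∃ e', e = e' + 1 := by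
      cases e with
      | zero => simp at h
      | succ e => exact ⟨e, rfl⟩
    rw [pow_succ] at h
    have i₁ := ih₁ e (by rw [hl.1]; omega)
    have i₂ := ih₂ e (by rw [hl.2]; omega)
    have hm := mergeT_cost_le key (sortT key p.val.1).val (sortT key p.val.2).val
    rw [sortT]
    simp only [Timed.cost_step, Timed.cost_spend, Timed.cost_bind]
    simp only [sortT_length] at hm
    have hs : p.val.1.length + p.val.2.length = (a :: b :: l).length := by
      have := (splitT_perm (a :: b :: l)).length_eq
      simpa using this
    -- With `L` the length, this level and the linear terms of the halves amount to `3L + 5`; the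
    -- claim allows `5L + 1`, which suffices because `L ≥ 2`.
    have h2 : 2 ≤ (a :: b :: l).length := by simp
    have e1 : 4 * p.val.1.length * e + 4 * p.val.2.length * e
        = 4 * (a :: b :: l).length * e := by rw [← hs]; ring
    have e2 : 4 * (a :: b :: l).length * (e + 1)
        = 4 * (a :: b :: l).length * e + 4 * (a :: b :: l).length := by ring
    rw [e2]
    change (sortT key p.val.1).cost + ((sortT key p.val.2).cost +
      (mergeT key (sortT key p.val.1).val (sortT key p.val.2).val).cost) +
      (splitT (a :: b :: l)).cost + 1 ≤ _
    omega

theorem emitBlock_val [LinearOrder κ] (key : β → κ) (c : κ) (f : β → γ) (rest : List γ)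
    (l : List β) : (emitBlock key c f rest l).val =
      (l.takeWhile fun b => key b = c).map f ++ rest := by
  induction l with
  | nil => rfl
  | cons b l ih =>
    by_cases h : key b = c <;> simp [emitBlock, h, ih]

/-- Every step but the last emits a row, so the cost is charged to the output; the length of `rest`
stands on the left to avoid subtraction. -/
theorem emitBlock_cost_le [LinearOrder κ] (key : β → κ) (c : κ) (f : β → γ) (rest : List γ)
    (l : List β) : (emitBlock key c f rest l).cost + rest.length ≤
      (emitBlock key c f rest l).val.length + 1 := by
  induction l with
  | nil => simp [emitBlock, Nat.add_comm]
  | cons b l ih =>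
    by_cases h : key b = c
    · simp only [emitBlock, h, if_true, Timed.cost_step, Timed.cost_bind, Timed.cost_pure,
        Timed.val_step, Timed.val_bind, Timed.val_pure, List.length_cons]
      omega
    · simp [emitBlock, h, Nat.add_comm]

/-- In a sorted list with no key below `c`, the rows with key `c` form an initial block. -/
theorem takeWhile_key_eq_filter [LinearOrder κ] (key : β → κ) (c : κ) (l : List β)
    (h : l.Pairwise fun a b => key a ≤ key b) (hc : ∀ b ∈ l, c ≤ key b) :
    (l.takeWhile fun b => key b = c) = l.filter fun b => key b = c := by
  induction l with
  | nil => rfl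
  | cons b l ih =>
    rw [List.pairwise_cons] at h
    by_cases hb : key b = c
    · simp [hb, ih h.2 fun x hx => hc x (List.mem_cons_of_mem _ hx)]
    · have hlt : c < key b := lt_of_le_of_ne (hc b List.mem_cons_self) (Ne.symm hb)
      simp only [hb, decide_false, Bool.false_eq_true, not_false_eq_true,
        List.takeWhile_cons_of_neg, List.filter_cons_of_neg]
      symm
      rw [List.filter_eq_nil_iff]
      intro x hx
      have hne := (hlt.trans_le (h.1 x hx)).ne'
      simpa using hne

/-- The merge phase yields exactly the pairs with equal keys. -/
theorem mergeJoin_val [LinearOrder κ] (key₁ : α → κ) (key₂ : β → κ) (f : α → β → γ)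
    (l₁ : List α) (l₂ : List β) (h₁ : l₁.Pairwise fun a b => key₁ a ≤ key₁ b)
    (h₂ : l₂.Pairwise fun a b => key₂ a ≤ key₂ b) :
    ((mergeJoin key₁ key₂ f l₁ l₂).val).Perm
      (l₁.flatMap fun a => (l₂.filter fun b => key₂ b = key₁ a).map (f a)) := by
  induction l₁, l₂ using mergeJoin.induct with
  | case1 l₂ => simp [mergeJoin]
  | case2 a l₁ => simp [mergeJoin]
  | case3 a l₁ b l₂ ih ih' =>
    by_cases h : key₁ a < key₂ b
    · rw [mergeJoin, if_pos h, List.flatMap_cons]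
      have : ((b :: l₂).filter fun b => key₂ b = key₁ a) = [] := by
        rw [List.filter_eq_nil_iff]
        intro x hx
        have : key₂ b ≤ key₂ x := by
          rcases List.mem_cons.1 hx with rfl | hx
          · exact le_rfl
          · exact (List.pairwise_cons.1 h₂).1 x hx
        simpa using (h.trans_le this).ne'
      rw [this]
      exact ih (List.pairwise_cons.1 h₁).2 h₂
    by_cases h' : key₂ b < key₁ a
    · rw [mergeJoin, if_neg h, if_pos h']
      refine (ih' h₁ (List.pairwise_cons.1 h₂).2).trans (List.Perm.of_eq ?_)
      refine List.flatMap_congr fun x hx => ?_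
      have : key₁ a ≤ key₁ x := by
        rcases List.mem_cons.1 hx with rfl | hx
        · exact le_rfl
        · exact (List.pairwise_cons.1 h₁).1 x hx
      rw [List.filter_cons_of_neg (by simpa using (h'.trans_le this).ne)]
    · rw [mergeJoin, if_neg h, if_neg h']
      -- Only `a` is consumed here: the block of `b` must stay available for later rows of `l₁` with
      -- the same key.
      have hab : key₂ b = key₁ a := le_antisymm (not_lt.1 h) (not_lt.1 h')
      simp only [Timed.val_step, Timed.val_bind, emitBlock_val]
      rw [takeWhile_key_eq_filter key₂ _ _ h₂ ?_, List.flatMap_cons]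
      · exact (ih (List.pairwise_cons.1 h₁).2 h₂).append_left _
      · intro x hx
        rcases List.mem_cons.1 hx with rfl | hx
        · exact hab.ge
        · exact hab.ge.trans ((List.pairwise_cons.1 h₂).1 x hx)

/-- Each step drops a row or emits one; the coefficient `2` of `l₁.length` also pays for the step in
which a row of `l₁` meets the end of its block. -/
theorem mergeJoin_cost_le [LinearOrder κ] (key₁ : α → κ) (key₂ : β → κ) (f : α → β → γ)
    (l₁ : List α) (l₂ : List β) :
    (mergeJoin key₁ key₂ f l₁ l₂).cost ≤
      2 * l₁.length + l₂.length + 1 + (mergeJoin key₁ key₂ f l₁ l₂).val.length := by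
  induction l₁, l₂ using mergeJoin.induct with
  | case1 l₂ => simp [mergeJoin]
  | case2 a l₁ => simp [mergeJoin]
  | case3 a l₁ b l₂ ih ih' =>
    by_cases h : key₁ a < key₂ b
    · rw [mergeJoin, if_pos h]
      simp only [Timed.cost_step, Timed.val_step, List.length_cons] at ih ⊢
      omega
    by_cases h' : key₂ b < key₁ a
    · rw [mergeJoin, if_neg h, if_pos h']
      simp only [Timed.cost_step, Timed.val_step, List.length_cons] at ih' ⊢
      omega
    · rw [mergeJoin, if_neg h, if_neg h']
      have he := emitBlock_cost_le key₂ (key₁ a) (f a)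
        (mergeJoin key₁ key₂ f l₁ (b :: l₂)).val (b :: l₂)
      simp only [Timed.cost_step, Timed.val_step, Timed.cost_bind, Timed.val_bind,
        List.length_cons] at ih ⊢
      omega

/-- Merged rows have the same tuple, so they satisfy `p` together or not at all. No sorting is
needed for this; sorting matters only for distinctness. -/
theorem collapseFrom_sum [LinearOrder α] (p : α → Prop) [DecidablePred p] (r : α × ℕ)
    (l : List (α × ℕ)) :
    ((collapseFrom r l).val.map fun s => if p s.1 then s.2 else 0).sum =
      ((r :: l).map fun s => if p s.1 then s.2 else 0).sum := by
  induction l generalizing r with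
  | nil => rfl
  | cons s l ih =>
    by_cases h : s.1 = r.1
    · simp only [collapseFrom, h, if_true, Timed.val_step, ih, List.map_cons, List.sum_cons]
      split_ifs <;> omega
    · simp only [collapseFrom, h, if_false, Timed.val_step, Timed.val_bind, Timed.val_pure, ih,
        List.map_cons, List.sum_cons]

theorem collapse_sum [LinearOrder α] (p : α → Prop) [DecidablePred p] (l : List (α × ℕ)) :
    ((collapse l).val.map fun s => if p s.1 then s.2 else 0).sum =
      (l.map fun s => if p s.1 then s.2 else 0).sum := by
  cases l with
  | nil => rfl
  | cons r l => exact collapseFrom_sum p r l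

theorem collapseFrom_mem [LinearOrder α] (r : α × ℕ) (l : List (α × ℕ)) {s : α × ℕ}
    (hs : s ∈ (collapseFrom r l).val) : ∃ s' ∈ r :: l, s'.1 = s.1 := by
  induction l generalizing r with
  | nil => exact ⟨r, by simp, by simp_all [collapseFrom]⟩
  | cons q l ih =>
    by_cases h : q.1 = r.1
    · simp only [collapseFrom, h, if_true, Timed.val_step] at hs
      obtain ⟨s', h', e⟩ := ih _ hs
      rcases List.mem_cons.1 h' with rfl | h'
      · exact ⟨r, by simp, e⟩
      · exact ⟨s', by simp [h'], e⟩
    · simp only [collapseFrom, h, if_false, Timed.val_step, Timed.val_bind, Timed.val_pure,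
        List.mem_cons] at hs
      rcases hs with rfl | hs
      · exact ⟨s, by simp, rfl⟩
      · obtain ⟨s', h', e⟩ := ih _ hs
        exact ⟨s', List.mem_cons_of_mem _ h', e⟩

theorem collapse_mem [LinearOrder α] (l : List (α × ℕ)) {s : α × ℕ}
    (hs : s ∈ (collapse l).val) : ∃ s' ∈ l, s'.1 = s.1 := by
  cases l with
  | nil => simp [collapse] at hs
  | cons r l => exact collapseFrom_mem r l hs

/-- Once a sorted list moves on to a new tuple, all later tuples are strictly larger than the old
one. -/
theorem collapseFrom_nodup [LinearOrder α] (r : α × ℕ) (l : List (α × ℕ))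
    (h : (r :: l).Pairwise fun a b => a.1 ≤ b.1) :
    ((collapseFrom r l).val.map Prod.fst).Nodup := by
  induction l generalizing r with
  | nil => simp [collapseFrom]
  | cons q l ih =>
    rw [List.pairwise_cons, List.pairwise_cons] at h
    by_cases hq : q.1 = r.1
    · simp only [collapseFrom, hq, if_true, Timed.val_step]
      refine ih _ (List.pairwise_cons.2 ⟨fun x hx => ?_, h.2.2⟩)
      exact hq ▸ h.2.1 x hx
    · simp only [collapseFrom, hq, if_false, Timed.val_step, Timed.val_bind, Timed.val_pure,
        List.map_cons, List.nodup_cons]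
      refine ⟨?_, ih _ (List.pairwise_cons.2 h.2)⟩
      intro hr
      obtain ⟨s, hs, e⟩ := List.mem_map.1 hr
      obtain ⟨s', hs', e'⟩ := collapseFrom_mem _ _ hs
      have hlt : r.1 < q.1 := lt_of_le_of_ne (h.1 q List.mem_cons_self) (Ne.symm hq)
      have : q.1 ≤ s'.1 := by
        rcases List.mem_cons.1 hs' with rfl | hs'
        · exact le_rfl
        · exact h.2.1 _ hs'
      exact (hlt.trans_le this).ne (by rw [e', e])

theorem collapse_nodup [LinearOrder α] (l : List (α × ℕ))
    (h : l.Pairwise fun a b => a.1 ≤ b.1) : ((collapse l).val.map Prod.fst).Nodup := by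
  cases l with
  | nil => simp [collapse]
  | cons r l => exact collapseFrom_nodup r l h

theorem collapseFrom_length_le [LinearOrder α] (r : α × ℕ) (l : List (α × ℕ)) :
    (collapseFrom r l).val.length ≤ l.length + 1 := by
  induction l generalizing r with
  | nil => simp [collapseFrom]
  | cons q l ih =>
    by_cases hq : q.1 = r.1
    · simp only [collapseFrom, hq, if_true, Timed.val_step, List.length_cons]
      exact (ih _).trans (Nat.le_succ _)
    · simp only [collapseFrom, hq, if_false, Timed.val_step, Timed.val_bind, Timed.val_pure,
        List.length_cons]
      exact Nat.succ_le_succ (ih _)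

theorem collapse_length_le [LinearOrder α] (l : List (α × ℕ)) :
    (collapse l).val.length ≤ l.length := by
  cases l with
  | nil => simp [collapse]
  | cons r l => exact collapseFrom_length_le r l

theorem collapseFrom_cost [LinearOrder α] (r : α × ℕ) (l : List (α × ℕ)) :
    (collapseFrom r l).cost = l.length + 1 := by
  induction l generalizing r with
  | nil => simp [collapseFrom]
  | cons q l ih => by_cases hq : q.1 = r.1 <;> simp [collapseFrom, hq, ih]

theorem collapse_cost [LinearOrder α] (l : List (α × ℕ)) :
    (collapse l).cost = l.length + 1 := by
  cases l with
  | nil => simp [collapse]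
  | cons r l => simp [collapse, collapseFrom_cost]

end Lists

-- Tables as weight functions on assignments

section Tables

variable {k m : ℕ} {Dom : Fin k → Type u}

/-- The tuple over `S` given by a total assignment of values to the attributes. -/
def onAttrs (S : Finset (Fin k)) (σ : ∀ a, Dom a) : Tuple Dom S := fun a => σ a

theorem onAttrs_eq_iff {S : Finset (Fin k)} {σ : ∀ a, Dom a} {t : Tuple Dom S} :
    t = onAttrs S σ ↔ ∀ a (h : a ∈ S), t ⟨a, h⟩ = σ a :=
  ⟨fun h a ha => by rw [h]; rfl, fun h => funext fun a => h a a.2⟩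

theorem onAttrs_congr {S : Finset (Fin k)} {σ τ : ∀ a, Dom a} (h : ∀ a ∈ S, σ a = τ a) :
    onAttrs S σ = onAttrs S τ := funext fun a => h a a.2

/-- The sum of `F` over all assignments that take values in `V` at the attributes in `A` and agree
with a given assignment elsewhere. -/
def marg (V : ∀ a, Finset (Dom a)) (A : Finset (Fin k)) (F : (∀ a, Dom a) → ℕ)
    (σ : ∀ a, Dom a) : ℕ :=
  ∑ x ∈ Fintype.piFinset (fun a => if a ∈ A then V a else {σ a}), F x

theorem mem_margBox {V : ∀ a, Finset (Dom a)} {A : Finset (Fin k)} {σ x : ∀ a, Dom a} :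
    x ∈ Fintype.piFinset (fun a => if a ∈ A then V a else {σ a}) ↔
      (∀ a ∈ A, x a ∈ V a) ∧ ∀ a ∉ A, x a = σ a := by
  rw [Fintype.mem_piFinset]
  constructor
  · intro h
    exact ⟨fun a ha => by simpa [ha] using h a, fun a ha => by simpa [ha] using h a⟩
  · rintro ⟨h₁, h₂⟩ a
    by_cases ha : a ∈ A
    · simpa [ha] using h₁ a ha
    · simpa [ha] using h₂ a ha

/-- All values in the rows of the table belong to `V`. -/
def Table.Within (V : ∀ a, Finset (Dom a)) (R : Table Dom) : Prop :=
  ∀ r ∈ R.rows, ∀ a : {a // a ∈ R.schema}, r.1 a ∈ V a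

/-- This makes joins multiplicative: a pair of rows contributes to the join at `σ` exactly when each
row contributes to its own table at `σ`. -/
theorem restrict_eq_and_glue_eq_iff {S S' : Finset (Fin k)} (t : Tuple Dom S)
    (t' : Tuple Dom S') (σ : ∀ a, Dom a) :
    (t'.restrict (Finset.inter_subset_right (s₁ := S)) =
        t.restrict (Finset.inter_subset_left (s₂ := S')) ∧
      t.glue t' = onAttrs (S ∪ S') σ) ↔ t = onAttrs S σ ∧ t' = onAttrs S' σ := by
  simp only [onAttrs_eq_iff]
  constructor
  · rintro ⟨h, hg⟩
    have h₁ : ∀ a (ha : a ∈ S), t ⟨a, ha⟩ = σ a := fun a ha => by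
      have := hg a (Finset.mem_union_left _ ha)
      simpa [Tuple.glue, ha] using this
    refine ⟨h₁, fun a ha => ?_⟩
    by_cases hS : a ∈ S
    · have := congrFun h ⟨a, Finset.mem_inter.2 ⟨hS, ha⟩⟩
      simp only [Tuple.restrict] at this
      rw [this, h₁]
    · have := hg a (Finset.mem_union_right _ ha)
      simpa [Tuple.glue, hS] using this
  · rintro ⟨h, h'⟩
    refine ⟨funext fun a => ?_, fun a ha => ?_⟩
    · simp only [Tuple.restrict, h, h']
    · by_cases hS : a ∈ S <;> simp [Tuple.glue, hS, h, h']

variable [∀ a, LinearOrder (Dom a)]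

/-- The total count of those rows of a table that agree with an assignment. -/
noncomputable def Table.weight (R : Table Dom) (σ : ∀ a, Dom a) : ℕ :=
  (R.rows.map fun r => if r.1 = onAttrs R.schema σ then r.2 else 0).sum

/-- With distinct rows, at most one term of the weight is nonzero, so counts can be read off as
weights. -/
theorem Table.weight_eq_of_mem (R : Table Dom) (hR : (R.rows.map Prod.fst).Nodup)
    {r : Tuple Dom R.schema × ℕ} (hr : r ∈ R.rows) {σ : ∀ a, Dom a}
    (h : r.1 = onAttrs R.schema σ) : R.weight σ = r.2 := by
  unfold Table.weight
  rw [← h]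
  generalize R.rows = l at *
  induction l with
  | nil => simp at hr
  | cons s l ih =>
    simp only [List.map_cons, List.nodup_cons, List.mem_map, not_exists, not_and] at hR
    rw [List.map_cons, List.sum_cons]
    rcases List.mem_cons.1 hr with rfl | hr
    · rw [if_pos rfl]
      have : (l.map fun s => if s.1 = r.1 then s.2 else 0).sum = 0 := by
        rw [List.sum_eq_zero]
        intro x hx
        obtain ⟨s, hs, rfl⟩ := List.mem_map.1 hx
        exact if_neg (hR.1 s hs)
      omega
    · rw [ih hR.2 hr, if_neg fun e => hR.1 r hr e.symm, zero_add]

theorem Table.exists_mem_of_weight_ne_zero (R : Table Dom) {σ : ∀ a, Dom a}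
    (h : R.weight σ ≠ 0) : ∃ r ∈ R.rows, r.1 = onAttrs R.schema σ := by
  by_contra! hc
  apply h
  rw [Table.weight, List.sum_eq_zero]
  intro x hx
  obtain ⟨s, hs, rfl⟩ := List.mem_map.1 hx
  exact if_neg (hc s hs)

/-! ### Joins -/

theorem join_rows_perm (R R' : Table Dom) :
    (show List (Tuple Dom (R.schema ∪ R'.schema) × ℕ) from (join R R').val.rows).Perm
      (R.rows.flatMap fun r => (R'.rows.filter fun r' =>
        r'.1.restrict (Finset.inter_subset_right (s₁ := R.schema)) =
          r.1.restrict (Finset.inter_subset_left (s₂ := R'.schema))).map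
        fun r' => (r.1.glue r'.1, r.2 * r'.2)) := by
  refine (mergeJoin_val _ _ _ _ _ (sortT_sorted _ _) (sortT_sorted _ _)).trans ?_
  refine (List.Perm.flatMap_right _ (sortT_perm _ _)).trans ?_
  exact List.Perm.flatMap_left _ fun a _ => ((sortT_perm _ _).filter _).map _

/-- Distributivity over pairs of rows, each pair being settled by `restrict_eq_and_glue_eq_iff`. -/
theorem join_weight (R R' : Table Dom) (σ : ∀ a, Dom a) :
    (join R R').val.weight σ = R.weight σ * R'.weight σ := by
  have h := (join_rows_perm R R').map
    fun r => if r.1 = onAttrs (R.schema ∪ R'.schema) σ then r.2 else 0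
  refine h.sum_eq.trans ?_
  unfold Table.weight
  induction R.rows with
  | nil => simp
  | cons r l ih =>
    rw [List.flatMap_cons, List.map_append, List.sum_append, ih, List.map_cons, List.sum_cons,
      add_mul]
    congr 1
    induction R'.rows with
    | nil => simp
    | cons r' l' ih' =>
      rw [List.map_cons, List.sum_cons, mul_add, ← ih']
      have key := restrict_eq_and_glue_eq_iff r.1 r'.1 σ
      by_cases hk : r'.1.restrict (Finset.inter_subset_right (s₁ := R.schema)) =
          r.1.restrict (Finset.inter_subset_left (s₂ := R'.schema))
      · rw [List.filter_cons_of_pos (by simpa using hk), List.map_cons, List.map_cons,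
          List.sum_cons]
        congr 1
        simp only [hk, true_and] at key
        by_cases h₁ : r.1 = onAttrs R.schema σ <;> by_cases h₂ : r'.1 = onAttrs R'.schema σ <;>
          simp_all
      · rw [List.filter_cons_of_neg (by simpa using hk)]
        simp only [hk, false_and, false_iff, not_and] at key
        by_cases h₁ : r.1 = onAttrs R.schema σ
        · simp [key h₁]
        · simp [h₁]

theorem join_within {V : ∀ a, Finset (Dom a)} {R R' : Table Dom} (h : R.Within V)
    (h' : R'.Within V) : (join R R').val.Within V := by
  intro r hr a
  have hr := (join_rows_perm R R').mem_iff.1 hr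
  obtain ⟨s, hs, hr⟩ := List.mem_flatMap.1 hr
  obtain ⟨s', hs', rfl⟩ := List.mem_map.1 hr
  change Tuple.glue s.1 s'.1 (show {a // a ∈ R.schema ∪ R'.schema} from a) ∈ V a
  unfold Tuple.glue
  split_ifs with ha
  · exact h s hs ⟨a, ha⟩
  · exact h' s' (List.mem_of_mem_filter hs') ⟨a, (Finset.mem_union.1 a.2).resolve_left ha⟩

theorem length_flatMap_le_mul {α β : Type*} (l : List α) (f : α → List β) (N : ℕ)
    (h : ∀ a ∈ l, (f a).length ≤ N) : (l.flatMap f).length ≤ l.length * N := by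
  induction l with
  | nil => simp
  | cons a l ih =>
    rw [List.flatMap_cons, List.length_append, List.length_cons, add_mul, one_mul]
    have h₁ := h a List.mem_cons_self
    have h₂ := ih fun b hb => h b (List.mem_cons_of_mem _ hb)
    omega

theorem join_length_le_mul (R R' : Table Dom) :
    (join R R').val.rows.length ≤ R.rows.length * R'.rows.length := by
  refine (join_rows_perm R R').length_eq.trans_le (length_flatMap_le_mul _ _ _ fun r _ => ?_)
  rw [List.length_map]
  exact List.length_filter_le _ _

/-- Joining with a table that has distinct rows and no new attributes does not increase the number
of rows. -/
theorem join_length_le (R R' : Table Dom) (hR' : (R'.rows.map Prod.fst).Nodup)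
    (hs : R'.schema ⊆ R.schema) : (join R R').val.rows.length ≤ R.rows.length := by
  refine (join_rows_perm R R').length_eq.trans_le
    ((length_flatMap_le_mul _ _ 1 fun r _ => ?_).trans (mul_one _).le)
  rw [List.length_map]
  -- The join key of a row of `R'` is the whole row, so two rows matching the same `r` are equal.
  have key : ∀ s s' : Tuple Dom R'.schema,
      s.restrict (Finset.inter_subset_right (s₁ := R.schema)) =
        s'.restrict (Finset.inter_subset_right (s₁ := R.schema)) → s = s' := by
    intro s s' h
    funext a
    exact congrFun h ⟨a, Finset.mem_inter.2 ⟨hs a.2, a.2⟩⟩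
  have hn : ((R'.rows.filter fun r' =>
        r'.1.restrict (Finset.inter_subset_right (s₁ := R.schema)) =
          r.1.restrict (Finset.inter_subset_left (s₂ := R'.schema))).map Prod.fst).Nodup :=
    hR'.sublist (List.filter_sublist.map _)
  generalize hl : (R'.rows.filter fun r' =>
        r'.1.restrict (Finset.inter_subset_right (s₁ := R.schema)) =
          r.1.restrict (Finset.inter_subset_left (s₂ := R'.schema))) = l at hn
  have hm : ∀ x ∈ l, x.1.restrict (Finset.inter_subset_right (s₁ := R.schema)) =
          r.1.restrict (Finset.inter_subset_left (s₂ := R'.schema)) := by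
    intro x hx
    rw [← hl] at hx
    simpa using (List.mem_filter.1 hx).2
  match l with
  | [] => simp
  | [x] => simp
  | x :: y :: l =>
    exfalso
    simp only [List.map_cons, List.nodup_cons, List.mem_cons, not_or] at hn
    exact hn.1.1 (key _ _ ((hm x (by simp)).trans (hm y (by simp)).symm))

/-- Separate exponents, because in the third pass the left table grows like a power of `n` while the
right one does not. -/
theorem join_cost_le (R R' : Table Dom) {e e' : ℕ} (h : R.rows.length ≤ 2 ^ e)
    (h' : R'.rows.length ≤ 2 ^ e') :
    (join R R').cost ≤ 4 * R.rows.length * e + 3 * R.rows.length + 4 * R'.rows.length * e' +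
      2 * R'.rows.length + (join R R').val.rows.length + 4 := by
  have h₁ := sortT_cost_le (fun r : Tuple Dom R.schema × ℕ =>
    r.1.restrict (Finset.inter_subset_left (s₂ := R'.schema))) R.rows e h
  have h₂ := sortT_cost_le (fun r : Tuple Dom R'.schema × ℕ =>
    r.1.restrict (Finset.inter_subset_right (s₁ := R.schema))) R'.rows e' h'
  have h₃ := mergeJoin_cost_le (fun r : Tuple Dom R.schema × ℕ =>
      r.1.restrict (Finset.inter_subset_left (s₂ := R'.schema)))
    (fun r : Tuple Dom R'.schema × ℕ =>
      r.1.restrict (Finset.inter_subset_right (s₁ := R.schema)))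
    (fun r r' => (r.1.glue r'.1, r.2 * r'.2))
    (sortT (fun r : Tuple Dom R.schema × ℕ =>
      r.1.restrict (Finset.inter_subset_left (s₂ := R'.schema))) R.rows).val
    (sortT (fun r : Tuple Dom R'.schema × ℕ =>
      r.1.restrict (Finset.inter_subset_right (s₁ := R.schema))) R'.rows).val
  simp only [sortT_length] at h₃
  simp only [join, Timed.cost_step, Timed.val_step, Timed.cost_bind, Timed.val_bind,
    Timed.cost_pure, Timed.val_pure]
  omega

/-! ### Grouping -/

theorem groupBy_nodup (S : Finset (Fin k)) (R : Table Dom) :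
    ((groupBy S R).val.rows.map Prod.fst).Nodup :=
  collapse_nodup _ (sortT_sorted _ _)

theorem groupBy_length_le (S : Finset (Fin k)) (R : Table Dom) :
    (groupBy S R).val.rows.length ≤ R.rows.length := by
  refine (collapse_length_le _).trans ?_
  simp

theorem groupBy_within {V : ∀ a, Finset (Dom a)} {R : Table Dom} (S : Finset (Fin k))
    (h : R.Within V) : (groupBy S R).val.Within V := by
  intro r hr a
  obtain ⟨s, hs, e⟩ := collapse_mem _ hr
  rw [← e]
  have hs := (sortT_perm _ _).mem_iff.1 hs
  rw [mapT_val] at hs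
  obtain ⟨s', hs', rfl⟩ := List.mem_map.1 hs
  exact h s' hs' ⟨a, Finset.inter_subset_right (s₁ := S) a.2⟩

theorem groupBy_cost_le (S : Finset (Fin k)) (R : Table Dom) {e : ℕ}
    (h : R.rows.length ≤ 2 ^ e) :
    (groupBy S R).cost ≤ 4 * R.rows.length * e + 3 * R.rows.length + 4 := by
  have h₁ := sortT_cost_le (fun r : Tuple Dom (S ∩ R.schema) × ℕ => r.1)
    (mapT (fun r : Tuple Dom R.schema × ℕ =>
      (r.1.restrict (Finset.inter_subset_right (s₁ := S)), r.2)) R.rows).val e (by simpa using h)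
  simp only [groupBy, Timed.cost_step, Timed.cost_bind, Timed.cost_pure, collapse_cost,
    sortT_length, mapT_cost]
  simp only [mapT_val, List.length_map] at h₁ ⊢
  omega

/-- The one-row case of `groupBy_weight`: at most one assignment in the box matches the row. -/
theorem sum_margBox_single {V : ∀ a, Finset (Dom a)} (S S' : Finset (Fin k))
    (r : Tuple Dom S') (hr : ∀ a : {a // a ∈ S'}, r a ∈ V a) (c : ℕ) (σ : ∀ a, Dom a) :
    (if r.restrict (Finset.inter_subset_right (s₁ := S)) = onAttrs (S ∩ S') σ then c else 0) =
      marg V (S' \ S) (fun x => if r = onAttrs S' x then c else 0) σ := by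
  unfold marg
  -- The only candidate: the values of the row on `S'`, and `σ` elsewhere. It lies in the box
  -- because the row takes its values in `V`.
  set x₀ : ∀ a, Dom a := fun a => if h : a ∈ S' then r ⟨a, h⟩ else σ a with hx₀
  split_ifs with h
  · have hmem : x₀ ∈ Fintype.piFinset (fun a => if a ∈ S' \ S then V a else {σ a}) := by
      rw [mem_margBox]
      refine ⟨fun a ha => ?_, fun a ha => ?_⟩
      · have ha' := (Finset.mem_sdiff.1 ha).1
        simpa [hx₀, ha'] using hr ⟨a, ha'⟩
      · by_cases ha' : a ∈ S'
        · have haS : a ∈ S := by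
            by_contra hS
            exact ha (Finset.mem_sdiff.2 ⟨ha', hS⟩)
          simpa [hx₀, ha', Tuple.restrict] using
            onAttrs_eq_iff.1 h a (Finset.mem_inter.2 ⟨haS, ha'⟩)
        · simp [hx₀, ha']
    rw [Finset.sum_eq_single_of_mem x₀ hmem]
    · rw [if_pos]
      rw [onAttrs_eq_iff]
      intro a ha
      simp [hx₀, ha]
    · intro x hx hne
      rw [if_neg]
      intro he
      apply hne
      funext a
      rw [mem_margBox] at hx
      by_cases ha : a ∈ S'
      · simpa [hx₀, ha] using (onAttrs_eq_iff.1 he a ha).symm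
      · simpa [hx₀, ha] using hx.2 a fun h => ha (Finset.mem_sdiff.1 h).1
  · symm
    refine Finset.sum_eq_zero fun x hx => if_neg fun he => h ?_
    rw [onAttrs_eq_iff]
    intro a ha
    rw [mem_margBox] at hx
    rw [← hx.2 a fun h => (Finset.mem_sdiff.1 h).2 (Finset.mem_inter.1 ha).1]
    exact onAttrs_eq_iff.1 he a (Finset.mem_inter.1 ha).2

/-- By linearity one row suffices. `Within` guarantees that the finite sum over `V` misses no row.
-/
theorem groupBy_weight {V : ∀ a, Finset (Dom a)} (S : Finset (Fin k)) (R : Table Dom)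
    (h : R.Within V) (σ : ∀ a, Dom a) :
    (groupBy S R).val.weight σ = marg V (R.schema \ S) R.weight σ := by
  refine (collapse_sum (fun t => t = onAttrs (S ∩ R.schema) σ) _).trans ?_
  refine ((sortT_perm _ _).map _).sum_eq.trans ?_
  rw [mapT_val, List.map_map]
  have h' : ∀ r ∈ R.rows, ∀ a : {a // a ∈ R.schema}, r.1 a ∈ V a := h
  clear h
  unfold Table.weight
  revert h'
  induction R.rows with
  | nil => simp [marg]
  | cons r l ih =>
    intro h'
    rw [List.map_cons, List.sum_cons, ih fun s hs => h' s (List.mem_cons_of_mem _ hs)]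
    simp only [List.map_cons, List.sum_cons]
    unfold marg
    rw [Finset.sum_add_distrib]
    congr 1
    exact sum_margBox_single S R.schema r.1 (h' r List.mem_cons_self) r.2 σ

theorem countTable_weight {Q : Query k m} (D : Database Q Dom) (i : Fin m) (σ : ∀ a, Dom a) :
    (countTable D i).val.weight σ = (D i).count (onAttrs (Q i) σ) := by
  refine (collapse_sum (fun t => t = onAttrs (Q i ∩ Q i) σ) _).trans ?_
  refine ((sortT_perm _ _).map _).sum_eq.trans ?_
  rw [mapT_val, mapT_val, List.map_map, List.map_map]
  induction D i with
  | nil => simp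
  | cons t l ih =>
    rw [List.map_cons, List.sum_cons, ih, List.count_cons, add_comm]
    congr 1
    simp only [Function.comp, beq_iff_eq]
    congr 1
    simp only [onAttrs_eq_iff, Tuple.restrict, Finset.mem_inter, and_self]

theorem countTable_schema {Q : Query k m} (D : Database Q Dom) (i : Fin m) :
    (countTable D i).val.schema = Q i := Finset.inter_self _

theorem countTable_length_le {Q : Query k m} (D : Database Q Dom) (i : Fin m) :
    (countTable D i).val.rows.length ≤ (D i).length := by
  refine (groupBy_length_le _ _).trans ?_
  simp

theorem countTable_within {Q : Query k m} {V : ∀ a, Finset (Dom a)} (D : Database Q Dom)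
    (i : Fin m) (h : ∀ t ∈ D i, ∀ a : {a // a ∈ Q i}, t a ∈ V a) :
    (countTable D i).val.Within V := by
  refine groupBy_within _ fun r hr a => ?_
  simp only [mapT_val, List.mem_map] at hr
  obtain ⟨t, ht, rfl⟩ := hr
  exact h t ht a

theorem countTable_cost_le {Q : Query k m} (D : Database Q Dom) (i : Fin m) {e : ℕ}
    (h : (D i).length ≤ 2 ^ e) :
    (countTable D i).cost ≤ 4 * (D i).length * e + 4 * (D i).length + 6 := by
  have := groupBy_cost_le (Q i) ⟨Q i, (mapT (fun t => (t, 1)) (D i)).val⟩ (e := e)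
    (by simpa using h)
  simp only [countTable, Timed.cost_step, Timed.cost_bind, mapT_cost]
  simp only [mapT_val, List.length_map] at this ⊢
  omega

end Tables

-- Algebra of finite marginals

section Marginals

variable {k m : ℕ} {Dom : Fin k → Type u} {V : ∀ a, Finset (Dom a)}

@[simp] theorem marg_empty (F : (∀ a, Dom a) → ℕ) : marg V ∅ F = F := by
  funext σ
  simp [marg, Fintype.piFinset_singleton]

/-- Replacing the fixed coordinates `σ` by `τ` is a bijection between the two boxes that does not
change `F`. -/
theorem marg_dependsOn {A S : Finset (Fin k)} {F : (∀ a, Dom a) → ℕ} (hF : DependsOn F S) :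
    DependsOn (marg V A F) (↑(S \ A) : Set (Fin k)) := by
  intro σ τ h
  refine Finset.sum_nbij' (fun x a => if a ∈ A then x a else τ a)
    (fun x a => if a ∈ A then x a else σ a) ?_ ?_ ?_ ?_ ?_
  · intro x hx
    rw [mem_margBox] at hx ⊢
    exact ⟨fun a ha => by simpa [ha] using hx.1 a ha, fun a ha => by simp [ha]⟩
  · intro x hx
    rw [mem_margBox] at hx ⊢
    exact ⟨fun a ha => by simpa [ha] using hx.1 a ha, fun a ha => by simp [ha]⟩
  · intro x hx
    rw [mem_margBox] at hx
    funext a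
    by_cases ha : a ∈ A
    · simp [ha]
    · simp [ha, hx.2 a ha]
  · intro x hx
    rw [mem_margBox] at hx
    funext a
    by_cases ha : a ∈ A
    · simp [ha]
    · simp [ha, hx.2 a ha]
  · intro x hx
    rw [mem_margBox] at hx
    refine hF fun a ha => ?_
    by_cases ha' : a ∈ A
    · simp [ha']
    · simp only [ha', if_false, hx.2 a ha']
      exact h a (by simpa [ha'] using ha)

/-- Fubini: an assignment in the large box determines its intermediate point, obtained by resetting
the coordinates in `B` to `σ`. -/
theorem marg_union {A B : Finset (Fin k)} (hAB : Disjoint A B) (F : (∀ a, Dom a) → ℕ) :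
    marg V (A ∪ B) F = marg V A (marg V B F) := by
  funext σ
  unfold marg
  rw [Finset.sum_sigma']
  have hd : ∀ a, a ∈ A → a ∉ B := fun a ha hb => Finset.disjoint_left.1 hAB ha hb
  refine Finset.sum_nbij' (fun y => ⟨fun a => if a ∈ B then σ a else y a, y⟩) (fun p => p.2)
    ?_ ?_ ?_ ?_ ?_
  · intro y hy
    rw [mem_margBox] at hy
    rw [Finset.mem_sigma, mem_margBox, mem_margBox]
    refine ⟨⟨fun a ha => ?_, fun a ha => ?_⟩, fun a ha => ?_, fun a ha => ?_⟩
    · simpa [hd a ha] using hy.1 a (Finset.mem_union_left _ ha)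
    · by_cases hb : a ∈ B
      · simp [hb]
      · simpa [hb] using hy.2 a (by simp [ha, hb])
    · exact hy.1 a (Finset.mem_union_right _ ha)
    · simp [ha]
  · rintro ⟨x, y⟩ hp
    rw [Finset.mem_sigma, mem_margBox, mem_margBox] at hp
    obtain ⟨⟨h₁, h₂⟩, h₃, h₄⟩ := hp
    rw [mem_margBox]
    refine ⟨fun a ha => ?_, fun a ha => ?_⟩
    · by_cases hb : a ∈ B
      · exact h₃ a hb
      · have := h₁ a ((Finset.mem_union.1 ha).resolve_right hb)
        simp only at h₄ this ⊢
        rwa [h₄ a hb]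
    · rw [Finset.mem_union, not_or] at ha
      exact (h₄ a ha.2).trans (h₂ a ha.1)
  · intro y _
    rfl
  · rintro ⟨x, y⟩ hp
    rw [Finset.mem_sigma, mem_margBox, mem_margBox] at hp
    obtain ⟨⟨h₁, h₂⟩, h₃, h₄⟩ := hp
    simp only [Sigma.mk.injEq, heq_eq_eq, and_true]
    funext a
    by_cases hb : a ∈ B
    · simp only [hb, if_true]
      exact (h₂ a fun ha => hd a ha hb).symm
    · simp only [hb, if_false]
      exact h₄ a hb
  · intro y _
    rfl

theorem marg_mul {A S : Finset (Fin k)} {G : (∀ a, Dom a) → ℕ} (hG : DependsOn G S)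
    (hSA : Disjoint S A) (F : (∀ a, Dom a) → ℕ) : marg V A (G * F) = G * marg V A F := by
  funext σ
  unfold marg
  rw [Pi.mul_apply, Finset.mul_sum]
  refine Finset.sum_congr rfl fun x hx => ?_
  rw [mem_margBox] at hx
  rw [Pi.mul_apply, hG fun a ha => hx.2 a (Finset.disjoint_left.1 hSA ha)]

/-- Each factor is constant along the variables summed in the other, so a product of sums is one sum
over both sets of variables. -/
theorem marg_mul_marg {A A' S S' : Finset (Fin k)} {F F' : (∀ a, Dom a) → ℕ}
    (hF : DependsOn F S) (hF' : DependsOn F' S') (h : Disjoint S A') (h' : Disjoint S' A)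
    (hA : Disjoint A A') : marg V A F * marg V A' F' = marg V (A ∪ A') (F * F') := by
  rw [marg_union hA, marg_mul hF h, mul_comm F, marg_mul (marg_dependsOn hF') _ F, mul_comm]
  exact Finset.disjoint_of_subset_left Finset.sdiff_subset h'

end Marginals

-- Messages and how they combine

section Messages

variable {k m : ℕ} {Dom : Fin k → Type u} (V : ∀ a, Finset (Dom a)) (Q : Query k m)
  (w : Fin m → (∀ a, Dom a) → ℕ)

/-- The attributes of a set of relations. -/
def attrsOf (X : Finset (Fin m)) : Finset (Fin k) := X.biUnion Q

/-- The product of the weights of the relations in `X`, summed over all attributes of these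
relations outside `S`. -/
def message (S : Finset (Fin k)) (X : Finset (Fin m)) : (∀ a, Dom a) → ℕ :=
  marg V (attrsOf Q X \ S) (∏ j ∈ X, w j)

variable {Q w}

theorem mem_attrsOf {X : Finset (Fin m)} {a : Fin k} : a ∈ attrsOf Q X ↔ ∃ j ∈ X, a ∈ Q j :=
  Finset.mem_biUnion

theorem prod_dependsOn (hw : ∀ j, DependsOn (w j) (Q j)) (X : Finset (Fin m)) :
    DependsOn (∏ j ∈ X, w j) (attrsOf Q X) := by
  intro σ τ h
  rw [Finset.prod_apply, Finset.prod_apply]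
  exact Finset.prod_congr rfl fun j hj => hw j fun a ha =>
    h a (mem_attrsOf.2 ⟨j, hj, ha⟩)

@[simp] theorem message_empty (S : Finset (Fin k)) : message V Q w S ∅ = 1 := by
  simp [message, attrsOf]

/-- Common attributes of `X` and `Y` lie in `S` and are not summed, so the two sums run over
independent variables. -/
theorem message_mul_message (hw : ∀ j, DependsOn (w j) (Q j)) {S : Finset (Fin k)}
    {X Y : Finset (Fin m)} (hXY : Disjoint X Y) (h : ∀ x ∈ X, ∀ y ∈ Y, Q x ∩ Q y ⊆ S) :
    message V Q w S X * message V Q w S Y = message V Q w S (X ∪ Y) := by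
  have key : ∀ a, a ∈ attrsOf Q X → a ∈ attrsOf Q Y → a ∈ S := by
    intro a ha hb
    obtain ⟨x, hx, ha⟩ := mem_attrsOf.1 ha
    obtain ⟨y, hy, hb⟩ := mem_attrsOf.1 hb
    exact h x hx y hy (Finset.mem_inter.2 ⟨ha, hb⟩)
  unfold message
  rw [marg_mul_marg (prod_dependsOn hw X) (prod_dependsOn hw Y), Finset.prod_union hXY]
  · congr 1
    rw [← Finset.union_sdiff_distrib]
    exact congrArg (· \ S) Finset.union_biUnion.symm
  · exact Finset.disjoint_left.2 fun a ha hb =>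
      (Finset.mem_sdiff.1 hb).2 (key a ha (Finset.mem_sdiff.1 hb).1)
  · exact Finset.disjoint_left.2 fun a ha hb =>
      (Finset.mem_sdiff.1 hb).2 (key a (Finset.mem_sdiff.1 hb).1 ha)
  · exact Finset.disjoint_left.2 fun a ha hb =>
      (Finset.mem_sdiff.1 ha).2 (key a (Finset.mem_sdiff.1 ha).1 (Finset.mem_sdiff.1 hb).1)

/-- Messages of disjoint parts that share attributes only within `S` multiply. -/
theorem prod_message (hw : ∀ j, DependsOn (w j) (Q j)) {S : Finset (Fin k)}
    (l : List (Finset (Fin m))) (hd : l.Pairwise Disjoint)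
    (h : ∀ X ∈ l, ∀ x ∈ X, ∀ y ∉ X, Q x ∩ Q y ⊆ S) :
    (l.map (message V Q w S)).prod = message V Q w S (l.foldr (· ∪ ·) ∅) := by
  induction l with
  | nil => simp
  | cons X l ih =>
    rw [List.pairwise_cons] at hd
    rw [List.map_cons, List.prod_cons, ih hd.2 fun Y hY => h Y (List.mem_cons_of_mem _ hY),
      List.foldr_cons]
    have hX : Disjoint X (l.foldr (· ∪ ·) ∅) := by
      clear ih h
      induction l with
      | nil => simp
      | cons Y l ih =>
        rw [List.foldr_cons, Finset.disjoint_union_right]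
        exact ⟨hd.1 Y List.mem_cons_self, ih ⟨fun Z hZ => hd.1 Z (List.mem_cons_of_mem _ hZ),
          (List.pairwise_cons.1 hd.2).2⟩⟩
    exact message_mul_message V hw hX fun x hx y hy =>
      h X List.mem_cons_self x hx y fun hyX => Finset.disjoint_left.1 hX hyX hy

/-- Summing out the attributes of `i` that do not belong to `P`. -/
theorem marg_mul_message (hw : ∀ j, DependsOn (w j) (Q j)) {P : Finset (Fin k)} {i : Fin m}
    {X : Finset (Fin m)} (hi : i ∉ X) (h : ∀ x ∈ X, Q x ∩ P ⊆ Q i) :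
    marg V (Q i \ P) (w i * message V Q w (Q i) X) = message V Q w P (insert i X) := by
  unfold message
  -- `w i` is constant under the inner sum and moves inside. The two sums then merge; by `h`, an
  -- attribute of `X` outside `Q i` is never in `P`, so exactly the attributes outside `P` are
  -- summed out.
  rw [← marg_mul (hw i) Finset.disjoint_sdiff, ← marg_union, Finset.prod_insert hi]
  · congr 1
    ext a
    simp only [Finset.mem_union, Finset.mem_sdiff, mem_attrsOf, Finset.mem_insert,
      exists_eq_or_imp]
    constructor
    · rintro (h' | ⟨⟨x, hx, ha⟩, h'⟩)
      · exact ⟨Or.inl h'.1, h'.2⟩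
      · exact ⟨Or.inr ⟨x, hx, ha⟩, fun hP => h' (h x hx (Finset.mem_inter.2 ⟨ha, hP⟩))⟩
    · rintro ⟨ha | ha, hP⟩
      · exact Or.inl ⟨ha, hP⟩
      · by_cases hQ : a ∈ Q i
        · exact Or.inl ⟨hQ, hP⟩
        · exact Or.inr ⟨ha, hQ⟩
  · exact Finset.disjoint_left.2 fun a ha hb =>
      (Finset.mem_sdiff.1 hb).2 (Finset.mem_sdiff.1 ha).1

end Messages

-- Sensitivity as a message

section Sensitivity

variable {k m : ℕ} {Dom : Fin k → Type u}

theorem Query.subset_attrs (Q : Query k m) (j : Fin m) : Q j ⊆ Q.attrs :=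
  Finset.subset_biUnion_of_mem Q (Finset.mem_univ j)

variable [∀ a, LinearOrder (Dom a)] {Q : Query k m}

/-- For a fixed output row, compatibility decouples into one condition per relation, so the count of
choices factors. -/
theorem compatible_and_outputRow_eq_iff {D : Instance Q Dom} (f : ∀ i, (D i).ToType)
    (u : Tuple Dom Q.attrs) :
    (Compatible f ∧ u = outputRow f) ↔ ∀ j, (f j).1 = u.restrict (Q.subset_attrs j) := by
  constructor
  · rintro ⟨hf, rfl⟩ j
    funext a
    exact hf _ _ a _ _
  · intro h
    have hf : Compatible f := by
      intro i j a hi hj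
      rw [h i, h j]
      rfl
    refine ⟨hf, funext fun a => ?_⟩
    have ha : ∃ i, (a : Fin k) ∈ Q i := by simpa [Query.attrs] using a.2
    have h₁ : outputRow f a = (f ha.choose).1 ⟨a, ha.choose_spec⟩ := rfl
    rw [h₁, h]
    rfl

theorem card_filter_toType {α : Type*} [DecidableEq α] (s : Multiset α) (a : α) :
    (Finset.univ.filter fun y : s.ToType => y.1 = a).card = s.count a := by
  conv_rhs => rw [← Multiset.map_univ_coe s, Multiset.count_map]
  rw [Finset.card_def, Finset.filter_val]
  congr 1
  exact Multiset.filter_congr fun _ _ => eq_comm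

/-- The multiplicity of a row in the natural join is the product of the multiplicities of its
restrictions. -/
theorem count_answer (D : Instance Q Dom) (u : Tuple Dom Q.attrs) :
    (answer D).count u = ∏ j, (D j).count (u.restrict (Q.subset_attrs j)) := by
  classical
  rw [answer, Multiset.count_map, ← Finset.filter_val, ← Finset.card_def, Finset.filter_filter]
  simp only [compatible_and_outputRow_eq_iff]
  simp only [← card_filter_toType]
  rw [← Fintype.card_piFinset]
  congr 1
  ext f
  simp [Fintype.mem_piFinset]

theorem count_bagSymmDiff {α : Type u} [DecidableEq α] (s t : Multiset α) (a : α) :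
    (bagSymmDiff s t).count a = max (s.count a - t.count a) (t.count a - s.count a) := by
  simp [bagSymmDiff, Multiset.count_union, Multiset.count_sub]

theorem count_answer_update (D : Instance Q Dom) (i : Fin m) (B : Multiset (Tuple Dom (Q i)))
    (u : Tuple Dom Q.attrs) :
    (answer (Q := Q) (Function.update D i B)).count u =
      B.count (u.restrict (Q.subset_attrs i)) *
        ∏ j ∈ Finset.univ.erase i, (D j).count (u.restrict (Q.subset_attrs j)) := by
  rw [count_answer, ← Finset.mul_prod_erase _ _ (Finset.mem_univ i), Function.update_self]
  congr 1
  refine Finset.prod_congr rfl fun j hj => ?_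
  rw [Function.update_of_ne (Finset.ne_of_mem_erase hj)]

theorem count_answer_eq (D : Instance Q Dom) (i : Fin m) (u : Tuple Dom Q.attrs) :
    (answer D).count u = (D i).count (u.restrict (Q.subset_attrs i)) *
        ∏ j ∈ Finset.univ.erase i, (D j).count (u.restrict (Q.subset_attrs j)) := by
  rw [← count_answer_update, Function.update_eq_self]

/-- The multiplicity in the answer is linear in that of the restriction to `Q i`, which grows by one
precisely at `t`. -/
theorem count_up (D : Instance Q Dom) (i : Fin m) (t : Tuple Dom (Q i))
    (u : Tuple Dom Q.attrs) :
    (bagSymmDiff (answer (insertTuple D i t)) (answer D)).count u =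
      if u.restrict (Q.subset_attrs i) = t then
        ∏ j ∈ Finset.univ.erase i, (D j).count (u.restrict (Q.subset_attrs j)) else 0 := by
  rw [count_bagSymmDiff, insertTuple, count_answer_update, count_answer_eq D i,
    Multiset.count_cons]
  split_ifs with h
  · rw [add_mul, one_mul]
    omega
  · simp

/-- Only an inequality: if `t` does not occur in `D i`, deletion changes nothing. -/
theorem count_down_le (D : Instance Q Dom) (i : Fin m) (t : Tuple Dom (Q i))
    (u : Tuple Dom Q.attrs) :
    (bagSymmDiff (answer D) (answer (deleteTuple D i t))).count u ≤
      if u.restrict (Q.subset_attrs i) = t then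
        ∏ j ∈ Finset.univ.erase i, (D j).count (u.restrict (Q.subset_attrs j)) else 0 := by
  rw [count_bagSymmDiff, deleteTuple, count_answer_update, count_answer_eq D i]
  split_ifs with h
  · rw [h, Multiset.count_erase_self]
    cases (D i).count t with
    | zero => simp
    | succ c =>
      rw [Nat.add_sub_cancel, add_mul, one_mul]
      omega
  · rw [Multiset.count_erase_of_ne h]
    simp

theorem tupleSens_eq_upSens (D : Instance Q Dom) (t : Σ i, Tuple Dom (Q i)) :
    tupleSens D t = upSens D t := by
  refine max_eq_left (Multiset.card_le_card (Multiset.le_iff_count.2 fun u => ?_))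
  rw [count_up]
  exact count_down_le D t.1 t.2 u

variable [∀ a, Inhabited (Dom a)]

/-- A tuple, completed to a total assignment with default values. -/
def Tuple.extend {S : Finset (Fin k)} (t : Tuple Dom S) : ∀ a, Dom a :=
  fun a => if h : a ∈ S then t ⟨a, h⟩ else default

/-- The tuple sensitivity is the sum, over all assignments that extend the tuple, of the products
of the multiplicities in the other relations. -/
theorem tupleSens_eq_message {V : ∀ a, Finset (Dom a)} (D : Instance Q Dom)
    (hV : ∀ j, ∀ t ∈ D j, ∀ a : {a // a ∈ Q j}, t a ∈ V a) (i : Fin m) (t : Tuple Dom (Q i)) :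
    tupleSens D ⟨i, t⟩ = message V Q (fun j σ => (D j).count (onAttrs (Q j) σ)) (Q i)
      (Finset.univ.erase i) t.extend := by
  have hattrs : ∀ a, a ∈ Q.attrs → a ∉ Q i → a ∈ attrsOf Q (Finset.univ.erase i) \ Q i := by
    intro a ha hi
    obtain ⟨j, -, hj⟩ := Finset.mem_biUnion.1 ha
    refine Finset.mem_sdiff.2
      ⟨mem_attrsOf.2 ⟨j, Finset.mem_erase.2 ⟨?_, Finset.mem_univ j⟩, hj⟩, hi⟩
    rintro rfl
    exact hi hj
  rw [tupleSens_eq_upSens, upSens, message, marg]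
  set box := Fintype.piFinset
    (fun a => if a ∈ attrsOf Q (Finset.univ.erase i) \ Q i then V a else {t.extend a}) with hbox
  set M := bagSymmDiff (answer (insertTuple D i t)) (answer D) with hM
  -- Off `Q.attrs` every assignment in the box is fixed, so restriction to `Q.attrs` loses nothing.
  have hinj : Set.InjOn (onAttrs Q.attrs) (box : Set (∀ a, Dom a)) := by
    intro x hx y hy hxy
    rw [Finset.mem_coe, hbox, mem_margBox] at hx hy
    funext a
    by_cases ha : a ∈ Q.attrs
    · exact congrFun hxy ⟨a, ha⟩
    · have ha' : a ∉ attrsOf Q (Finset.univ.erase i) \ Q i := fun h => by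
        obtain ⟨j, -, hj⟩ := mem_attrsOf.1 (Finset.mem_sdiff.1 h).1
        exact ha (Q.subset_attrs j hj)
      rw [hx.2 a ha', hy.2 a ha']
  have hext : ∀ x ∈ box, (onAttrs Q.attrs x).restrict (Q.subset_attrs i) = t := by
    intro x hx
    rw [hbox, mem_margBox] at hx
    funext a
    change x a = t a
    rw [hx.2 a fun h => (Finset.mem_sdiff.1 h).2 a.2]
    simp [Tuple.extend]
  -- A row of the difference has all its restrictions to relations `j ≠ i` in the database, hence
  -- values in `V` outside `Q i`.
  have hcov : ∀ u ∈ M, u ∈ box.image (onAttrs Q.attrs) := by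
    intro u hu
    rw [← Multiset.count_ne_zero, hM, count_up] at hu
    split_ifs at hu with hut
    · rw [Finset.prod_ne_zero_iff] at hu
      -- The value `default` off `Q.attrs` is the one that `t.extend` prescribes there.
      refine Finset.mem_image.2 ⟨fun a => if h : a ∈ Q.attrs then u ⟨a, h⟩ else default, ?_, ?_⟩
      · rw [hbox, mem_margBox]
        refine ⟨fun a ha => ?_, fun a ha => ?_⟩
        · obtain ⟨j, hj, haj⟩ := mem_attrsOf.1 (Finset.mem_sdiff.1 ha).1
          have := hV j _ (Multiset.count_ne_zero.1 (hu j hj)) ⟨a, haj⟩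
          simpa [Q.subset_attrs j haj, Tuple.restrict] using this
        · by_cases hi : a ∈ Q i
          · simp [Tuple.extend, hi, Q.subset_attrs i hi, ← hut, Tuple.restrict]
          · have : a ∉ Q.attrs := fun h => ha (hattrs a h hi)
            simp [Tuple.extend, hi, this]
      · funext a
        simp [onAttrs]
    · exact absurd rfl hu
  rw [← Multiset.sum_count_eq_card hcov, Finset.sum_image hinj]
  refine Finset.sum_congr rfl fun x hx => ?_
  rw [hM, count_up, if_pos (hext x hx), Finset.prod_apply]
  rfl

end Sensitivity

-- Rooted trees and attaching leaves

namespace RTree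

variable {α : Type v}

/-- The recursor of this nested type has a second motive for lists of trees; it is fixed here as
"all members satisfy `P`". -/
theorem ind {P : RTree α → Prop} (h : ∀ a cs, (∀ c ∈ cs, P c) → P (node a cs)) (T : RTree α) :
    P T :=
  RTree.rec (motive_1 := P) (motive_2 := fun cs => ∀ c ∈ cs, P c) h (by simp)
    (fun _ _ hc hcs => List.forall_mem_cons.2 ⟨hc, hcs⟩) T

theorem nodesList_eq (cs : List (RTree α)) : nodesList cs = cs.flatMap nodes := by
  induction cs with
  | nil => rfl
  | cons c cs ih => rw [nodesList, ih, List.flatMap_cons]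

theorem mem_nodes_node {a x : α} {cs : List (RTree α)} :
    x ∈ (node a cs).nodes ↔ x = a ∨ ∃ c ∈ cs, x ∈ c.nodes := by
  rw [nodes, List.mem_cons, nodesList_eq, List.mem_flatMap]

theorem mem_edges_node {a : α} {cs : List (RTree α)} {e : α × α} :
    e ∈ (node a cs).edges ↔ ∃ c ∈ cs, e = (a, c.label) ∨ e ∈ c.edges := by
  rw [edges]
  induction cs with
  | nil => simp [edgesList]
  | cons c cs ih => simp [edgesList, ih, or_assoc]

theorem attachList_eq [DecidableEq α] (j i : α) (cs : List (RTree α)) :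
    attachList j i cs = cs.map (attach j i) := by
  induction cs with
  | nil => rfl
  | cons c cs ih => rw [attachList, ih, List.map_cons]

@[simp] theorem label_attach [DecidableEq α] (j i : α) (T : RTree α) :
    (T.attach j i).label = T.label := by
  cases T
  rw [attach]
  rfl

theorem label_mem_nodes (T : RTree α) : T.label ∈ T.nodes := by
  cases T
  simp [nodes, label]

theorem mem_nodes_of_mem_edges {T : RTree α} {a b : α} (h : (a, b) ∈ T.edges) :
    a ∈ T.nodes ∧ b ∈ T.nodes := by
  induction T using ind with
  | h x cs ih =>
    obtain ⟨c, hc, h | h⟩ := mem_edges_node.1 h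
    · simp only [Prod.mk.injEq] at h
      rw [h.1, h.2, mem_nodes_node, mem_nodes_node]
      exact ⟨Or.inl rfl, Or.inr ⟨c, hc, c.label_mem_nodes⟩⟩
    · rw [mem_nodes_node, mem_nodes_node]
      exact ⟨Or.inr ⟨c, hc, (ih c hc h).1⟩, Or.inr ⟨c, hc, (ih c hc h).2⟩⟩

/-- `attach` adds a leaf at every node labelled `j`, hence the multiplicity `count j`. -/
theorem coe_nodes_attach [DecidableEq α] (j i : α) (T : RTree α) :
    ((T.attach j i).nodes : Multiset α) =
      Multiset.replicate (T.nodes.count j) i + (T.nodes : Multiset α) := by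
  induction T using ind with
  | h a cs ih =>
    have hl : (nodesList (attachList j i cs) : Multiset α) =
        Multiset.replicate ((nodesList cs).count j) i + (nodesList cs : Multiset α) := by
      induction cs with
      | nil => simp [attachList, nodesList]
      | cons c cs ihl =>
        rw [attachList, nodesList, nodesList, ← Multiset.coe_add, ← Multiset.coe_add,
          ih c List.mem_cons_self, ihl fun x hx => ih x (List.mem_cons_of_mem _ hx),
          List.count_append, Multiset.replicate_add]
        ac_rfl
    rw [attach, nodes, nodes, ← Multiset.cons_coe, ← Multiset.cons_coe, List.count_cons]
    by_cases h : a = j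
    · simp only [h, if_true, nodesList, nodes, beq_self_eq_true, List.cons_append,
        List.nil_append, ← Multiset.cons_coe, hl, Multiset.replicate_succ, Multiset.cons_add,
        Multiset.add_cons]
    · simp only [h, if_false, hl, beq_iff_eq, add_zero, Multiset.add_cons]

theorem edges_subset_attach [DecidableEq α] (j i : α) (T : RTree α) :
    T.edges ⊆ (T.attach j i).edges := by
  induction T using ind with
  | h a cs ih =>
    intro e he
    obtain ⟨c, hc, h⟩ := mem_edges_node.1 he
    rw [attach, mem_edges_node]
    refine ⟨c.attach j i, ?_, ?_⟩
    · split_ifs <;> simp only [attachList_eq, List.mem_cons, List.mem_map]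
      · exact Or.inr ⟨c, hc, rfl⟩
      · exact ⟨c, hc, rfl⟩
    · rw [label_attach]
      exact h.imp_right fun h => ih c hc h

theorem mem_edges_attach [DecidableEq α] {j : α} (i : α) {T : RTree α} (hj : j ∈ T.nodes) :
    (j, i) ∈ (T.attach j i).edges := by
  induction T using ind with
  | h a cs ih =>
    rw [attach, mem_edges_node]
    by_cases h : a = j
    · exact ⟨node i [], by simp [h], Or.inl (by rw [h]; rfl)⟩
    · obtain ⟨c, hc, hjc⟩ := (mem_nodes_node.1 hj).resolve_left (Ne.symm h)
      refine ⟨c.attach j i, ?_, Or.inr (ih c hc hjc)⟩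
      simp only [h, if_false, attachList_eq, List.mem_map]
      exact ⟨c, hc, rfl⟩

theorem graph_adj {T : RTree α} {a b : α} :
    T.graph.Adj a b ↔ a ≠ b ∧ ((a, b) ∈ T.edges ∨ (b, a) ∈ T.edges) :=
  SimpleGraph.fromRel_adj _ _ _

end RTree

-- GYO trees, join trees and running intersection

section Acyclic

variable {k m : ℕ} {Q : Query k m}

theorem GYOReduces.exists_gyoTree {H : Finset (Fin m)} (h : GYOReduces Q H) (hH : H.Nonempty) :
    ∃ T, GYOTree Q H T := by
  induction h with
  | empty => simp at hH
  | @ear H i hi _ ih =>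
    have hins : insert i (H.erase i) = H := Finset.insert_erase hi.1
    rcases (H.erase i).eq_empty_or_nonempty with he | hne
    · rw [← hins, he]
      exact ⟨_, GYOTree.last i⟩
    · obtain ⟨T, hT⟩ := ih hne
      obtain ⟨j, hj, hij⟩ : ∃ j ∈ H.erase i,
          ∀ a ∈ Q i, (∀ l ∈ H.erase i, a ∉ Q l) ∨ a ∈ Q j := by
        -- An ear sharing no vertex may hang below any remaining hyperedge.
        rcases hi.2 with h | ⟨j, hj, hji, h⟩
        · obtain ⟨j, hj⟩ := hne
          exact ⟨j, hj, fun a ha => Or.inl fun l hl =>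
            h a ha l (Finset.mem_of_mem_erase hl) (Finset.ne_of_mem_erase hl)⟩
        · exact ⟨j, Finset.mem_erase.2 ⟨hji, hj⟩, fun a ha => (h a ha).imp_left fun h l hl =>
            h l (Finset.mem_of_mem_erase hl) (Finset.ne_of_mem_erase hl)⟩
      exact ⟨_, hins ▸ GYOTree.ear hT (Finset.notMem_erase i H) hj hij⟩

theorem GYOTree.nodes_eq {H : Finset (Fin m)} {T : RTree (Fin m)} (h : GYOTree Q H T) :
    (T.nodes : Multiset (Fin m)) = H.val := by
  induction h with
  | last i => rfl
  | @ear H T i j _ hi hj _ ih =>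
    have hc : T.nodes.count j = 1 := by
      rw [← Multiset.coe_count, ih]
      exact Multiset.count_eq_one_of_mem H.nodup hj
    rw [RTree.coe_nodes_attach, hc, ih, Finset.insert_val_of_notMem hi]
    rfl

theorem GYOTree.mem_nodes {H : Finset (Fin m)} {T : RTree (Fin m)} (h : GYOTree Q H T)
    {i : Fin m} : i ∈ T.nodes ↔ i ∈ H := by
  rw [← Multiset.mem_coe, h.nodes_eq, Finset.mem_val]

/-- A path from the new leaf `i` is the edge to `j` followed by an old path; attributes shared by
`i` and an old relation lie in `Q j` by the ear condition. That old paths stay in `H` is carried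
along to see that `i` is not repeated. -/
theorem GYOTree.exists_path {H : Finset (Fin m)} {T : RTree (Fin m)} (h : GYOTree Q H T) :
    ∀ i ∈ H, ∀ j ∈ H, ∃ p : T.graph.Walk i j, p.IsPath ∧
      ∀ l ∈ p.support, l ∈ H ∧ Q i ∩ Q j ⊆ Q l := by
  induction h with
  | last i =>
    intro x hx y hy
    obtain rfl := Finset.mem_singleton.1 hx
    obtain rfl := Finset.mem_singleton.1 hy
    exact ⟨.nil, by simp, by simp⟩
  | @ear H T i j hT hi hj hij ih =>
    have hle : T.graph ≤ (T.attach j i).graph := by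
      intro a b hab
      rw [RTree.graph_adj] at hab ⊢
      exact ⟨hab.1, hab.2.imp (fun h => T.edges_subset_attach j i h)
        fun h => T.edges_subset_attach j i h⟩
    have hadj : (T.attach j i).graph.Adj i j := by
      rw [RTree.graph_adj]
      exact ⟨fun e => hi (e ▸ hj), Or.inr (RTree.mem_edges_attach i (hT.mem_nodes.2 hj))⟩
    have hnew : ∀ y ∈ H, ∃ p : (T.attach j i).graph.Walk i y, p.IsPath ∧
        ∀ l ∈ p.support, l ∈ insert i H ∧ Q i ∩ Q y ⊆ Q l := by
      intro y hy
      obtain ⟨p, hp, hl⟩ := ih j hj y hy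
      refine ⟨.cons hadj (p.mapLe hle), ?_, ?_⟩
      · rw [SimpleGraph.Walk.cons_isPath_iff]
        refine ⟨(SimpleGraph.Walk.isPath_mapLe hle).2 hp, fun h => ?_⟩
        rw [SimpleGraph.Walk.support_mapLe_eq_support] at h
        exact hi (hl i h).1
      · intro l h
        rw [SimpleGraph.Walk.support_cons, List.mem_cons,
          SimpleGraph.Walk.support_mapLe_eq_support] at h
        rcases h with rfl | h
        · exact ⟨Finset.mem_insert_self _ _, Finset.inter_subset_left⟩
        · refine ⟨Finset.mem_insert_of_mem (hl l h).1, fun a ha => (hl l h).2 ?_⟩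
          rw [Finset.mem_inter] at ha ⊢
          exact ⟨(hij a ha.1).resolve_left fun h' => h' y hy ha.2, ha.2⟩
    intro x hx y hy
    rcases Finset.mem_insert.1 hx with rfl | hx'
    · rcases Finset.mem_insert.1 hy with rfl | hy'
      · exact ⟨.nil, by simp, by simp⟩
      · exact hnew y hy'
    · rcases Finset.mem_insert.1 hy with rfl | hy'
      · obtain ⟨p, hp, hl⟩ := hnew x hx'
        refine ⟨p.reverse, hp.reverse, fun l h => ?_⟩
        rw [SimpleGraph.Walk.support_reverse, List.mem_reverse] at h
        rw [Finset.inter_comm]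
        exact hl l h
      · obtain ⟨p, hp, hl⟩ := ih x hx' y hy'
        refine ⟨p.mapLe hle, (SimpleGraph.Walk.isPath_mapLe hle).2 hp, fun l h => ?_⟩
        rw [SimpleGraph.Walk.support_mapLe_eq_support] at h
        exact ⟨Finset.mem_insert_of_mem (hl l h).1, (hl l h).2⟩

theorem GYOTree.isJoinTree {T : RTree (Fin m)} (h : GYOTree Q Finset.univ T) :
    IsJoinTree Q T where
  nodes_perm := by
    refine (List.perm_ext_iff_of_nodup ?_ (List.nodup_finRange m)).2 fun i => ?_
    · rw [← Multiset.coe_nodup, h.nodes_eq]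
      exact Finset.univ.nodup
    · simp [h.mem_nodes]
  path i j := by
    obtain ⟨p, hp, hl⟩ := h.exists_path i (Finset.mem_univ i) j (Finset.mem_univ j)
    exact ⟨p, hp, fun l h => (hl l h).2⟩

/-- The running intersection property: the relations below a child share attributes with other
relations only via the child and its parent. -/
inductive RunningIntersection (Q : Query k m) : RTree (Fin m) → Prop
  | node {i : Fin m} {cs : List (RTree (Fin m))} :
      (∀ c ∈ cs, ∀ x ∈ c.nodes, ∀ y ∉ c.nodes, Q x ∩ Q y ⊆ Q i ∩ Q c.label) →
      (∀ c ∈ cs, RunningIntersection Q c) → RunningIntersection Q (.node i cs)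

theorem RTree.nodup_node {i : Fin m} {cs : List (RTree (Fin m))}
    (h : (RTree.node i cs).nodes.Nodup) :
    (∀ c ∈ cs, i ∉ c.nodes) ∧ (∀ c ∈ cs, c.nodes.Nodup) ∧
      cs.Pairwise fun c c' => c.nodes.Disjoint c'.nodes := by
  rw [RTree.nodes, RTree.nodesList_eq, List.nodup_cons, List.nodup_flatMap] at h
  exact ⟨fun c hc hi => h.1 (List.mem_flatMap.2 ⟨c, hc, hi⟩), h.2.1, h.2.2⟩

theorem RTree.eq_of_mem_nodes {i x : Fin m} {cs : List (RTree (Fin m))}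
    (h : (RTree.node i cs).nodes.Nodup) {c c' : RTree (Fin m)} (hc : c ∈ cs) (hc' : c' ∈ cs)
    (hx : x ∈ c.nodes) (hx' : x ∈ c'.nodes) : c = c' := by
  by_contra hne
  have : Std.Symm fun c c' : RTree (Fin m) => c.nodes.Disjoint c'.nodes := ⟨fun _ _ h => h.symm⟩
  exact List.Pairwise.forall (R := fun c c' : RTree (Fin m) => c.nodes.Disjoint c'.nodes)
    (RTree.nodup_node h).2.2 hc hc' hne hx hx'

/-- A walk from inside a child's subtree to the outside must cross the edge between the child and
its parent, so shared attributes lie in both. The graph stays fixed during the induction; `o` admits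
edges that leave the current subtree from its root. -/
theorem runningIntersection_of_graph (G : SimpleGraph (Fin m))
    (hG : ∀ i j : Fin m, ∃ p : G.Walk i j, ∀ l ∈ p.support, Q i ∩ Q j ⊆ Q l)
    (T : RTree (Fin m)) (hT : T.nodes.Nodup) (o : Fin m → Prop)
    (h : ∀ x ∈ T.nodes, ∀ y, G.Adj x y →
      (x, y) ∈ T.edges ∨ (y, x) ∈ T.edges ∨ (x = T.label ∧ o y)) :
    RunningIntersection Q T := by
  induction T using RTree.ind generalizing o with
  | h i cs ih =>
    obtain ⟨h₁, h₂, -⟩ := RTree.nodup_node hT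
    have hsub : ∀ c ∈ cs, ∀ x ∈ c.nodes, ∀ y, G.Adj x y →
        (x, y) ∈ c.edges ∨ (y, x) ∈ c.edges ∨ (x = c.label ∧ y = i) := by
      intro c hc x hx y hxy
      rcases h x (RTree.mem_nodes_node.2 (Or.inr ⟨c, hc, hx⟩)) y hxy with h | h | h
      · obtain ⟨c', hc', h | h⟩ := RTree.mem_edges_node.1 h
        · simp only [Prod.mk.injEq] at h
          exact absurd (h.1 ▸ hx) (h₁ c hc)
        · obtain rfl := RTree.eq_of_mem_nodes hT hc hc' hx (RTree.mem_nodes_of_mem_edges h).1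
          exact Or.inl h
      · obtain ⟨c', hc', h | h⟩ := RTree.mem_edges_node.1 h
        · simp only [Prod.mk.injEq] at h
          obtain rfl := RTree.eq_of_mem_nodes hT hc hc' hx (h.2 ▸ c'.label_mem_nodes)
          exact Or.inr (Or.inr ⟨h.2, h.1⟩)
        · obtain rfl := RTree.eq_of_mem_nodes hT hc hc' hx (RTree.mem_nodes_of_mem_edges h).2
          exact Or.inr (Or.inl h)
      · have hxi : x = i := h.1
        exact absurd (hxi ▸ hx) (h₁ c hc)
    refine .node (fun c hc x hx y hy => ?_) fun c hc => ih c hc (h₂ c hc) (· = i) (hsub c hc)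
    obtain ⟨p, hp⟩ := hG x y
    obtain ⟨d, hd, hd₁, hd₂⟩ := p.exists_boundary_dart {z | z ∈ c.nodes} hx hy
    rcases hsub c hc _ hd₁ _ d.adj with h | h | h
    · exact absurd (RTree.mem_nodes_of_mem_edges h).2 hd₂
    · exact absurd (RTree.mem_nodes_of_mem_edges h).1 hd₂
    · have e₁ := hp _ (p.dart_fst_mem_support_of_mem_darts hd)
      have e₂ := hp _ (p.dart_snd_mem_support_of_mem_darts hd)
      rw [h.1] at e₁
      rw [h.2] at e₂
      exact Finset.subset_inter e₂ e₁

theorem IsJoinTree.nodup {T : RTree (Fin m)} (h : IsJoinTree Q T) : T.nodes.Nodup :=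
  h.nodes_perm.nodup_iff.2 (List.nodup_finRange m)

theorem IsJoinTree.runningIntersection {T : RTree (Fin m)} (h : IsJoinTree Q T) :
    RunningIntersection Q T := by
  refine runningIntersection_of_graph T.graph (fun i j => ?_) T h.nodup (fun _ => False) ?_
  · obtain ⟨p, -, hp⟩ := h.path i j
    exact ⟨p, hp⟩
  · intro x _ y hxy
    rcases (RTree.graph_adj.1 hxy).2 with h | h
    · exact Or.inl h
    · exact Or.inr (Or.inl h)

end Acyclic

-- Repeated joins: weights, sizes and costs

section Joins

variable {k m : ℕ} {Dom : Fin k → Type u} [∀ a, LinearOrder (Dom a)]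

theorem joinFrom_weight (R : Table Dom) (l : List (Table Dom)) :
    (joinFrom R l).val.weight = R.weight * (l.map Table.weight).prod := by
  induction l generalizing R with
  | nil => simp [joinFrom]
  | cons R' l ih =>
    have hj : (join R R').val.weight = R.weight * R'.weight := funext fun σ => join_weight R R' σ
    rw [List.map_cons, List.prod_cons, ← mul_assoc, ← hj, ← ih]
    rfl

theorem joinFrom_within {V : ∀ a, Finset (Dom a)} {R : Table Dom} {l : List (Table Dom)}
    (h : R.Within V) (hl : ∀ R' ∈ l, R'.Within V) : (joinFrom R l).val.Within V := by
  induction l generalizing R with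
  | nil => exact h
  | cons R' l ih =>
    exact ih (join_within h (hl R' List.mem_cons_self)) fun S hS => hl S (List.mem_cons_of_mem _ hS)

theorem joinFrom_schema_subset {R : Table Dom} {l : List (Table Dom)} {S : Finset (Fin k)}
    (h : R.schema ⊆ S) (hl : ∀ R' ∈ l, R'.schema ⊆ S) : (joinFrom R l).val.schema ⊆ S := by
  induction l generalizing R with
  | nil => exact h
  | cons R' l ih =>
    exact ih (Finset.union_subset h (hl R' List.mem_cons_self))
      fun S hS => hl S (List.mem_cons_of_mem _ hS)

theorem joinFrom_schema {R : Table Dom} {l : List (Table Dom)}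
    (hl : ∀ R' ∈ l, R'.schema ⊆ R.schema) : (joinFrom R l).val.schema = R.schema := by
  induction l generalizing R with
  | nil => rfl
  | cons R' l ih =>
    have hs : (join R R').val.schema = R.schema :=
      Finset.union_eq_left.2 (hl R' List.mem_cons_self)
    refine (ih (R := (join R R').val) fun S hS => ?_).trans hs
    rw [hs]
    exact hl S (List.mem_cons_of_mem _ hS)

theorem joinFrom_length_le {R : Table Dom} {l : List (Table Dom)}
    (hl : ∀ R' ∈ l, R'.schema ⊆ R.schema ∧ (R'.rows.map Prod.fst).Nodup) :
    (joinFrom R l).val.rows.length ≤ R.rows.length := by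
  induction l generalizing R with
  | nil => exact le_rfl
  | cons R' l ih =>
    have h := hl R' List.mem_cons_self
    have hs : (join R R').val.schema = R.schema := Finset.union_eq_left.2 h.1
    refine (ih (R := (join R R').val) fun S hS => ?_).trans (join_length_le R R' h.2 h.1)
    rw [hs]
    exact hl S (List.mem_cons_of_mem _ hS)

/-- By `join_length_le` the accumulated table never exceeds `N` rows, so every join has the same
bound. -/
theorem joinFrom_cost_le {R : Table Dom} {l : List (Table Dom)} {N e : ℕ} (hN : N ≤ 2 ^ e)
    (hR : R.rows.length ≤ N) (hl : ∀ R' ∈ l, R'.schema ⊆ R.schema ∧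
      (R'.rows.map Prod.fst).Nodup ∧ R'.rows.length ≤ N) :
    (joinFrom R l).cost ≤ l.length * (8 * (N * e) + 6 * N + 5) + 1 := by
  induction l generalizing R with
  | nil => simp [joinFrom]
  | cons R' l ih =>
    have h := hl R' List.mem_cons_self
    have hs : (join R R').val.schema = R.schema := Finset.union_eq_left.2 h.1
    have hlen := join_length_le R R' h.2.1 h.1
    have hc := join_cost_le R R' (hR.trans hN) (h.2.2.trans hN)
    have hi := ih (R := (join R R').val) (hlen.trans hR) fun S hS => by
      rw [hs]
      exact hl S (List.mem_cons_of_mem _ hS)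
    simp only [joinFrom, Timed.cost_step, Timed.cost_bind, List.length_cons]
    have e₁ : R.rows.length * e ≤ N * e := Nat.mul_le_mul_right _ hR
    have e₂ : R'.rows.length * e ≤ N * e := Nat.mul_le_mul_right _ h.2.2
    rw [mul_assoc, mul_assoc] at hc
    rw [add_mul, one_mul]
    omega

theorem joinFrom_length_le_pow {R : Table Dom} {l : List (Table Dom)} {N j : ℕ}
    (hR : R.rows.length ≤ N ^ j) (hl : ∀ R' ∈ l, R'.rows.length ≤ N) :
    (joinFrom R l).val.rows.length ≤ N ^ (j + l.length) := by
  induction l generalizing R j with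
  | nil => exact hR
  | cons R' l ih =>
    have h : (join R R').val.rows.length ≤ N ^ (j + 1) := by
      rw [pow_succ]
      exact (join_length_le_mul R R').trans
        (Nat.mul_le_mul hR (hl R' List.mem_cons_self))
    have := ih h fun S hS => hl S (List.mem_cons_of_mem _ hS)
    rw [List.length_cons, add_comm l.length, ← add_assoc]
    exact this

/-- A potential estimate in additive form: the join costs at most `18 * j * e` times the increment
from `N ^ j` to `N ^ (j + 1)`, so that successive joins telescope. -/
theorem join_cost_le_pow {R R' : Table Dom} {N e j : ℕ} (hN : N ≤ 2 ^ e) (hN₂ : 2 ≤ N)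
    (hj : 1 ≤ j) (hR : R.rows.length ≤ N ^ j) (hR' : R'.rows.length ≤ N) :
    (join R R').cost + 1 + 18 * (j * e * N ^ j) ≤ 18 * (j * e * N ^ (j + 1)) := by
  have he : 1 ≤ e := by
    rcases Nat.eq_zero_or_pos e with rfl | h
    · simp at hN; omega
    · exact h
  have hNj : N ^ j ≤ 2 ^ (e * j) := by
    rw [pow_mul]
    exact Nat.pow_le_pow_left hN j
  have hc := join_cost_le R R' (hR.trans hNj) (hR'.trans hN)
  have hlen : (join R R').val.rows.length ≤ N * N ^ j := by
    rw [mul_comm]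
    exact (join_length_le_mul R R').trans (Nat.mul_le_mul hR hR')
  have hN1 : N ≤ N ^ j := Nat.le_self_pow (by omega) N
  have h₁ : R.rows.length * (e * j) ≤ j * e * N ^ j := by
    rw [mul_comm (j * e), mul_comm j]
    exact Nat.mul_le_mul_right _ hR
  have h₂ : R'.rows.length * e ≤ j * e * N ^ j := by
    calc R'.rows.length * e ≤ N ^ j * e := Nat.mul_le_mul_right _ (hR'.trans hN1)
      _ = 1 * e * N ^ j := by ring
      _ ≤ j * e * N ^ j := by gcongr
  have h₃ : N ^ j ≤ j * e * N ^ j := Nat.le_mul_of_pos_left _ (Nat.mul_pos hj he)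
  have h₄ : N * N ^ j ≤ j * e * (N * N ^ j) := Nat.le_mul_of_pos_left _ (Nat.mul_pos hj he)
  -- Geometric growth, from `2 ≤ N`: all terms of order `N ^ j` are absorbed by half of the next
  -- power.
  have h₅ : 2 * (j * e * N ^ j) ≤ j * e * (N * N ^ j) := by
    calc 2 * (j * e * N ^ j) = j * e * (2 * N ^ j) := by ring
      _ ≤ _ := by gcongr
  rw [mul_assoc, mul_assoc] at hc
  rw [pow_succ, mul_comm (N ^ j) N]
  omega

/-- Telescoping `join_cost_le_pow` leaves only the last power, so no additional factor for the
number of joins appears. -/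
theorem joinFrom_cost_le_pow {R : Table Dom} {l : List (Table Dom)} {N e j : ℕ}
    (hN : N ≤ 2 ^ e) (hN₂ : 2 ≤ N) (hj : 1 ≤ j) (hR : R.rows.length ≤ N ^ j)
    (hl : ∀ R' ∈ l, R'.rows.length ≤ N) :
    (joinFrom R l).cost + 18 * ((j + l.length) * e * N ^ j) ≤
      18 * ((j + l.length) * e * N ^ (j + l.length)) + 1 := by
  induction l generalizing R j with
  | nil => simp [joinFrom, Nat.add_comm]
  | cons R' l ih =>
    have hR' := hl R' List.mem_cons_self
    have h : (join R R').val.rows.length ≤ N ^ (j + 1) := by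
      rw [pow_succ]
      exact (join_length_le_mul R R').trans (Nat.mul_le_mul hR hR')
    have hi := ih (by omega) h fun S hS => hl S (List.mem_cons_of_mem _ hS)
    have hc := join_cost_le_pow hN hN₂ hj hR hR'
    simp only [joinFrom, Timed.cost_step, Timed.cost_bind, List.length_cons]
    have e₁ : j + 1 + l.length = j + (l.length + 1) := by omega
    rw [e₁] at hi
    have e₂ : (j + (l.length + 1)) * e * N ^ j = j * e * N ^ j + (l.length + 1) * e * N ^ j := by
      ring
    have e₃ : (j + (l.length + 1)) * e * N ^ (j + 1) =
        j * e * N ^ (j + 1) + (l.length + 1) * e * N ^ (j + 1) := by ring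
    have e₄ : (l.length + 1) * e * N ^ j ≤ (l.length + 1) * e * N ^ (j + 1) :=
      Nat.mul_le_mul_left _ (Nat.pow_le_pow_right (by omega) (by omega))
    omega

theorem joinAll_weight (l : List (Table Dom)) :
    (joinAll l).val.weight = (l.map Table.weight).prod := by
  cases l with
  | nil =>
    funext σ
    simp only [joinAll, Timed.val_step, Timed.val_pure, Table.weight, List.map_cons, List.map_nil,
      List.sum_cons, List.sum_nil, List.prod_nil, add_zero]
    exact if_pos (funext fun a => absurd a.2 (Finset.notMem_empty _))
  | cons R l => exact joinFrom_weight R l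

theorem joinAll_within {V : ∀ a, Finset (Dom a)} {l : List (Table Dom)}
    (hl : ∀ R ∈ l, R.Within V) : (joinAll l).val.Within V := by
  cases l with
  | nil =>
    intro r _ a
    exact absurd a.2 (Finset.notMem_empty _)
  | cons R l =>
    exact joinFrom_within (hl R List.mem_cons_self) fun S hS => hl S (List.mem_cons_of_mem _ hS)

theorem joinAll_schema_subset {l : List (Table Dom)} {S : Finset (Fin k)}
    (hl : ∀ R ∈ l, R.schema ⊆ S) : (joinAll l).val.schema ⊆ S := by
  cases l with
  | nil => exact Finset.empty_subset S
  | cons R l =>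
    exact joinFrom_schema_subset (hl R List.mem_cons_self)
      fun S hS => hl S (List.mem_cons_of_mem _ hS)

theorem joinAll_length_le {l : List (Table Dom)} {N d : ℕ} (hN : 1 ≤ N) (hd : l.length ≤ d)
    (hl : ∀ R ∈ l, R.rows.length ≤ N) : (joinAll l).val.rows.length ≤ N ^ d := by
  cases l with
  | nil => exact Nat.one_le_pow _ _ hN
  | cons R l =>
    refine (joinFrom_length_le_pow (j := 1) (by simpa using hl R List.mem_cons_self)
      fun S hS => hl S (List.mem_cons_of_mem _ hS)).trans (Nat.pow_le_pow_right hN ?_)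
    rw [List.length_cons] at hd
    omega

theorem joinAll_cost_le {l : List (Table Dom)} {N e d : ℕ} (hN : N ≤ 2 ^ e) (hN₂ : 2 ≤ N)
    (hd : l.length ≤ d) (hl : ∀ R ∈ l, R.rows.length ≤ N) :
    (joinAll l).cost ≤ 18 * (d * e * N ^ d) + 2 := by
  cases l with
  | nil => simp [joinAll]
  | cons R l =>
    have h := joinFrom_cost_le_pow (j := 1) hN hN₂ le_rfl
      (by simpa using hl R List.mem_cons_self) fun S hS => hl S (List.mem_cons_of_mem _ hS)
    rw [List.length_cons, add_comm] at hd
    have h' : (1 + l.length) * e * N ^ (1 + l.length) ≤ d * e * N ^ d := by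
      gcongr
      omega
    simp only [joinAll, Timed.cost_step]
    omega

end Joins

-- Tables representing sets of relations

section Representation

variable {k m : ℕ} {Dom : Fin k → Type u}

/-- All values that occur in the database belong to `V`. -/
def Database.Within {Q : Query k m} (V : ∀ a, Finset (Dom a)) (D : Database Q Dom) : Prop :=
  ∀ j, ∀ t ∈ D j, ∀ a : {a // a ∈ Q j}, t a ∈ V a

theorem Database.length_le_size {Q : Query k m} (D : Database Q Dom) (i : Fin m) :
    (D i).length ≤ D.size :=
  Finset.single_le_sum (f := fun i => (D i).length) (fun _ _ => Nat.zero_le _)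
    (Finset.mem_univ i)

/-- The union of the represented sets of relations. -/
def partsUnion (ms : List (Table Dom × Finset (Fin m))) : Finset (Fin m) :=
  (ms.map Prod.snd).foldr (· ∪ ·) ∅

theorem mem_partsUnion {ms : List (Table Dom × Finset (Fin m))} {x : Fin m} :
    x ∈ partsUnion ms ↔ ∃ p ∈ ms, x ∈ p.2 := by
  unfold partsUnion
  induction ms with
  | nil => simp
  | cons p ms ih => simp [ih]

theorem mem_partsUnion_append {ms ms' : List (Table Dom × Finset (Fin m))} {x : Fin m} :
    x ∈ partsUnion (ms ++ ms') ↔ x ∈ partsUnion ms ∨ x ∈ partsUnion ms' := by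
  simp only [mem_partsUnion, List.mem_append, or_and_right, exists_or]

variable [∀ a, LinearOrder (Dom a)]

/-- The multiplicity of an assignment in the relation `j`. -/
noncomputable def relWeight {Q : Query k m} (D : Database Q Dom) (j : Fin m) (σ : ∀ a, Dom a) : ℕ :=
  (D j).count (onAttrs (Q j) σ)

theorem relWeight_dependsOn {Q : Query k m} (D : Database Q Dom) (j : Fin m) :
    DependsOn (relWeight D j) (Q j) := by
  intro σ τ h
  rw [relWeight, relWeight, onAttrs_congr h]

/-- The table `R` holds the join of the relations in `X`, grouped by attributes in `S`. -/
structure Table.Represents {Q : Query k m} (V : ∀ a, Finset (Dom a)) (D : Database Q Dom)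
    (R : Table Dom) (S : Finset (Fin k)) (X : Finset (Fin m)) : Prop where
  schema_subset : R.schema ⊆ S
  nodup : (R.rows.map Prod.fst).Nodup
  within : R.Within V
  length_le : R.rows.length ≤ D.size
  weight_eq : R.weight = message V Q (relWeight D) S X

/-- The tables in `ms` represent pairwise disjoint sets of relations that share attributes with
other relations only within `S`. -/
structure Parts {Q : Query k m} (V : ∀ a, Finset (Dom a)) (D : Database Q Dom)
    (S : Finset (Fin k)) (ms : List (Table Dom × Finset (Fin m))) : Prop where
  represents : ∀ p ∈ ms, p.1.Represents V D S p.2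
  disjoint : ms.Pairwise fun p q => Disjoint p.2 q.2
  separated : ∀ p ∈ ms, ∀ x ∈ p.2, ∀ y ∉ p.2, Q x ∩ Q y ⊆ S

theorem Parts.sublist {Q : Query k m} {V : ∀ a, Finset (Dom a)} {D : Database Q Dom}
    {S : Finset (Fin k)} {ms ms' : List (Table Dom × Finset (Fin m))} (h : Parts V D S ms)
    (hs : ms'.Sublist ms) : Parts V D S ms' where
  represents p hp := h.represents p (hs.subset hp)
  disjoint := h.disjoint.sublist hs
  separated p hp := h.separated p (hs.subset hp)

theorem Parts.prod_weight {Q : Query k m} {V : ∀ a, Finset (Dom a)} {D : Database Q Dom}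
    {S : Finset (Fin k)} {ms : List (Table Dom × Finset (Fin m))} (h : Parts V D S ms) :
    ((ms.map Prod.fst).map Table.weight).prod =
      message V Q (relWeight D) S (partsUnion ms) := by
  rw [partsUnion, ← prod_message V (relWeight_dependsOn D)]
  · rw [List.map_map, List.map_map]
    congr 1
    exact List.map_congr_left fun p hp => (h.represents p hp).weight_eq
  · exact List.pairwise_map.2 h.disjoint
  · intro X hX
    obtain ⟨p, hp, rfl⟩ := List.mem_map.1 hX
    exact h.separated p hp

/-- Joining a relation with the parts around it and grouping by attributes in `P`. -/
theorem Parts.groupBy_joinFrom {Q : Query k m} {V : ∀ a, Finset (Dom a)} {D : Database Q Dom}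
    (hV : D.Within V) {i : Fin m} {ms : List (Table Dom × Finset (Fin m))}
    (h : Parts V D (Q i) ms) (hi : i ∉ partsUnion ms) {P G : Finset (Fin k)} (hGP : G ⊆ P)
    (hG : Q i \ G = Q i \ P) (hP : ∀ x ∈ partsUnion ms, Q x ∩ P ⊆ Q i) :
    (groupBy G (joinFrom (countTable D i).val (ms.map Prod.fst)).val).val.Represents V D P
      (insert i (partsUnion ms)) := by
  have hs := countTable_schema D i
  have hl : ∀ R' ∈ ms.map Prod.fst, R'.schema ⊆ (countTable D i).val.schema ∧
      (R'.rows.map Prod.fst).Nodup := by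
    intro R' hR'
    obtain ⟨p, hp, rfl⟩ := List.mem_map.1 hR'
    exact ⟨hs.symm ▸ (h.represents p hp).schema_subset, (h.represents p hp).nodup⟩
  have hw : (joinFrom (countTable D i).val (ms.map Prod.fst)).val.Within V := by
    refine joinFrom_within (countTable_within D i (hV i)) fun R' hR' => ?_
    obtain ⟨p, hp, rfl⟩ := List.mem_map.1 hR'
    exact (h.represents p hp).within
  refine ⟨Finset.inter_subset_left.trans hGP, groupBy_nodup _ _, groupBy_within _ hw, ?_, ?_⟩
  · exact (groupBy_length_le _ _).trans ((joinFrom_length_le hl).trans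
      ((countTable_length_le D i).trans (D.length_le_size i)))
  · have hc : (countTable D i).val.weight = relWeight D i :=
      funext fun σ => countTable_weight D i σ
    funext σ
    -- The algorithm groups by `G`, the message is relative to `P`; by `hG` both sum out the same
    -- attributes of `i`.
    rw [groupBy_weight G _ hw, joinFrom_schema fun R' hR' => (hl R' hR').1, hs, hG,
      joinFrom_weight, hc, h.prod_weight, marg_mul_message V (relWeight_dependsOn D) hi hP]

/-- Absorbing lower-order terms into `D.size * e` gives `19 = 8 + 6 + 5` per join and `12 = 1 + 4 +
3 + 4` for the end of the list and the grouping. -/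
theorem Parts.groupBy_joinFrom_cost_le {Q : Query k m} {V : ∀ a, Finset (Dom a)}
    {D : Database Q Dom} {i : Fin m} {ms : List (Table Dom × Finset (Fin m))}
    (h : Parts V D (Q i) ms) (G : Finset (Fin k)) {e : ℕ} (he : D.size ≤ 2 ^ e)
    (h₁ : 1 ≤ D.size * e) :
    (joinFrom (countTable D i).val (ms.map Prod.fst)).cost +
      (groupBy G (joinFrom (countTable D i).val (ms.map Prod.fst)).val).cost ≤
      (19 * ms.length + 12) * (D.size * e) := by
  have hs := countTable_schema D i
  have hR := (countTable_length_le D i).trans (D.length_le_size i)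
  have hl : ∀ R' ∈ ms.map Prod.fst, R'.schema ⊆ (countTable D i).val.schema ∧
      (R'.rows.map Prod.fst).Nodup ∧ R'.rows.length ≤ D.size := by
    intro R' hR'
    obtain ⟨p, hp, rfl⟩ := List.mem_map.1 hR'
    exact ⟨hs.symm ▸ (h.represents p hp).schema_subset, (h.represents p hp).nodup,
      (h.represents p hp).length_le⟩
  have hlen := (joinFrom_length_le fun R' hR' => ⟨(hl R' hR').1, (hl R' hR').2.1⟩).trans hR
  have hc := joinFrom_cost_le he hR hl
  have hg := groupBy_cost_le G _ (hlen.trans he)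
  have he₁ : 1 ≤ e := Nat.pos_of_ne_zero fun h => by simp [h] at h₁
  have hn : D.size ≤ D.size * e := Nat.le_mul_of_pos_right _ he₁
  rw [List.length_map] at hc
  have hm : ms.length * (8 * (D.size * e) + 6 * D.size + 5) ≤
      ms.length * (19 * (D.size * e)) := Nat.mul_le_mul_left _ (by omega)
  have hm' := Nat.mul_le_mul_right e hlen
  rw [mul_assoc] at hg
  have : (19 * ms.length + 12) * (D.size * e) =
      ms.length * (19 * (D.size * e)) + 12 * (D.size * e) := by ring
  omega

end Representation

-- Degrees and node counts

namespace RTree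

variable {α : Type v}

theorem length_add_le_of_maxDegreeAux_le {a : α} {cs : List (RTree α)} {e d : ℕ}
    (h : maxDegreeAux e (node a cs) ≤ d) : cs.length + e ≤ d := by
  rw [maxDegreeAux] at h
  exact (le_max_left _ _).trans h

theorem maxDegreeAux_one_le {a : α} {cs : List (RTree α)} {e d : ℕ}
    (h : maxDegreeAux e (node a cs) ≤ d) : ∀ c ∈ cs, maxDegreeAux 1 c ≤ d := by
  rw [maxDegreeAux] at h
  replace h := (le_max_right _ _).trans h
  induction cs with
  | nil => simp
  | cons c cs ih =>
    rw [maxDegreeList] at h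
    exact List.forall_mem_cons.2 ⟨(le_max_left _ _).trans h, ih ((le_max_right _ _).trans h)⟩

theorem length_nodes_node (a : α) (cs : List (RTree α)) :
    (node a cs).nodes.length = (cs.map fun c => c.nodes.length).sum + 1 := by
  rw [nodes, nodesList_eq, List.length_cons, List.length_flatMap]

end RTree

theorem sum_map_le_mul_sum {α : Type*} {l : List α} {f g : α → ℕ} {K : ℕ}
    (h : ∀ a ∈ l, f a ≤ K * g a) : (l.map f).sum ≤ K * (l.map g).sum := by
  rw [← List.sum_map_mul_left]
  exact List.sum_le_sum h

-- First pass: botjoins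

section BotPass

variable {k m : ℕ} {Dom : Fin k → Type u} [∀ a, LinearOrder (Dom a)] {Q : Query k m}

theorem botPassList_val (D : Database Q Dom) (P : Finset (Fin k)) (cs : List (RTree (Fin m))) :
    (botPassList D P cs).val = cs.map fun c => (botPass D P c).val := by
  induction cs with
  | nil => rw [botPassList]; rfl
  | cons c cs ih =>
    simp only [botPassList, Timed.val_step, Timed.val_bind, Timed.val_pure, ih, List.map_cons]

theorem botPassList_cost (D : Database Q Dom) (P : Finset (Fin k)) (cs : List (RTree (Fin m))) :
    (botPassList D P cs).cost = (cs.map fun c => (botPass D P c).cost).sum + cs.length + 1 := by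
  induction cs with
  | nil => rw [botPassList]; rfl
  | cons c cs ih =>
    simp only [botPassList, Timed.cost_step, Timed.cost_bind, Timed.cost_pure, ih, List.map_cons,
      List.sum_cons, List.length_cons]
    omega

/-- The botjoins of the children `cs` of the relation `i`. -/
noncomputable def childBots (D : Database Q Dom) (i : Fin m) (cs : List (RTree (Fin m))) :
    List (Table Dom) :=
  cs.map fun c => (botPass D (Q i) c).val.label.bot

theorem botPass_val (D : Database Q Dom) (P : Finset (Fin k)) (i : Fin m)
    (cs : List (RTree (Fin m))) :
    (botPass D P (.node i cs)).val =
      .node ⟨i, (countTable D i).val,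
        (groupBy (Q i ∩ P) (joinFrom (countTable D i).val (childBots D i cs)).val).val⟩
        (cs.map fun c => (botPass D (Q i) c).val) := by
  simp only [botPass, Timed.val_step, Timed.val_bind, Timed.val_pure, mapT_val, botPassList_val,
    List.map_map]
  rfl

theorem botPass_cost (D : Database Q Dom) (P : Finset (Fin k)) (i : Fin m)
    (cs : List (RTree (Fin m))) :
    (botPass D P (.node i cs)).cost = (cs.map fun c => (botPass D (Q i) c).cost).sum +
      (countTable D i).cost + 2 * cs.length + 3 +
      ((joinFrom (countTable D i).val (childBots D i cs)).cost +
        (groupBy (Q i ∩ P) (joinFrom (countTable D i).val (childBots D i cs)).val).cost) := by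
  simp only [botPass, Timed.cost_step, Timed.cost_bind, Timed.cost_pure, mapT_val, mapT_cost,
    botPassList_val, botPassList_cost, List.map_map, List.length_map]
  change _ + (_ + (_ + ((joinFrom (countTable D i).val (childBots D i cs)).cost +
    ((groupBy (Q i ∩ P) (joinFrom (countTable D i).val (childBots D i cs)).val).cost + 0)))) + 1 = _
  omega

theorem botPass_label_idx (D : Database Q Dom) (P : Finset (Fin k)) (T : RTree (Fin m)) :
    (botPass D P T).val.label.idx = T.label := by
  cases T
  rw [botPass_val]
  rfl

theorem botPass_nodes (D : Database Q Dom) (P : Finset (Fin k)) (T : RTree (Fin m)) :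
    (botPass D P T).val.nodes.map BotInfo.idx = T.nodes := by
  induction T using RTree.ind generalizing P with
  | h i cs ih =>
    rw [botPass_val, RTree.nodes, RTree.nodes, List.map_cons, RTree.nodesList_eq,
      RTree.nodesList_eq, List.map_flatMap, List.flatMap_map]
    congr 1
    exact List.flatMap_congr fun c hc => ih c hc (Q i)

/-- The botjoins of the children `cs` of the relation `i`, with the relations that they cover. -/
noncomputable def childParts (D : Database Q Dom) (i : Fin m) (cs : List (RTree (Fin m))) :
    List (Table Dom × Finset (Fin m)) :=
  cs.map fun c => ((botPass D (Q i) c).val.label.bot, c.nodes.toFinset)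

theorem childParts_map_fst (D : Database Q Dom) (i : Fin m) (cs : List (RTree (Fin m))) :
    (childParts D i cs).map Prod.fst = childBots D i cs := by
  rw [childParts, childBots, List.map_map]
  rfl

theorem mem_partsUnion_childParts {D : Database Q Dom} {i : Fin m} {cs : List (RTree (Fin m))}
    {x : Fin m} : x ∈ partsUnion (childParts D i cs) ↔ ∃ c ∈ cs, x ∈ c.nodes := by
  simp [mem_partsUnion, childParts]

theorem RunningIntersection.separated {i : Fin m} {cs : List (RTree (Fin m))}
    (h : RunningIntersection Q (.node i cs)) : ∀ c ∈ cs, ∀ x ∈ c.nodes, ∀ y ∉ c.nodes,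
      Q x ∩ Q y ⊆ Q i ∩ Q c.label := by
  cases h with
  | node h _ => exact h

theorem RunningIntersection.child {i : Fin m} {cs : List (RTree (Fin m))}
    (h : RunningIntersection Q (.node i cs)) : ∀ c ∈ cs, RunningIntersection Q c := by
  cases h with
  | node _ h => exact h

variable {V : ∀ a, Finset (Dom a)} {D : Database Q Dom}

theorem childParts_parts {i : Fin m} {cs : List (RTree (Fin m))}
    (hn : (RTree.node i cs).nodes.Nodup) (hr : RunningIntersection Q (.node i cs))
    (h : ∀ c ∈ cs, (botPass D (Q i) c).val.label.bot.Represents V D (Q i) c.nodes.toFinset) :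
    Parts V D (Q i) (childParts D i cs) where
  represents p hp := by
    obtain ⟨c, hc, rfl⟩ := List.mem_map.1 hp
    exact h c hc
  disjoint := by
    rw [childParts, List.pairwise_map]
    refine (RTree.nodup_node hn).2.2.imp fun {c c'} h => ?_
    exact List.disjoint_toFinset_iff_disjoint.2 h
  separated p hp x hx y hy := by
    obtain ⟨c, hc, rfl⟩ := List.mem_map.1 hp
    exact (hr.separated c hc x (List.mem_toFinset.1 hx) y
      (fun h => hy (List.mem_toFinset.2 h))).trans Finset.inter_subset_left

/-- The botjoin at a node represents the relations of its subtree. -/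
theorem bot_represents (hV : D.Within V) (T : RTree (Fin m)) (hn : T.nodes.Nodup)
    (hr : RunningIntersection Q T) (P : Finset (Fin k))
    (hP : ∀ x ∈ T.nodes, Q x ∩ P ⊆ Q T.label) :
    (botPass D P T).val.label.bot.Represents V D P T.nodes.toFinset := by
  induction T using RTree.ind generalizing P with
  | h i cs ih =>
    obtain ⟨h₁, h₂, -⟩ := RTree.nodup_node hn
    -- The induction hypothesis is used with `P = Q i`; its condition is running intersection
    -- applied to `y = i`, which lies outside the child's subtree.
    have hp : Parts V D (Q i) (childParts D i cs) := childParts_parts hn hr fun c hc =>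
      ih c hc (h₂ c hc) (hr.child c hc) (Q i) fun x hx =>
        (hr.separated c hc x hx i (h₁ c hc)).trans Finset.inter_subset_right
    have hi : i ∉ partsUnion (childParts D i cs) := by
      rw [mem_partsUnion_childParts]
      rintro ⟨c, hc, h⟩
      exact h₁ c hc h
    have := hp.groupBy_joinFrom hV hi (P := P) (G := Q i ∩ P) Finset.inter_subset_right
      (Finset.sdiff_inter_self_left _ _) fun x hx =>
        hP x (RTree.mem_nodes_node.2 (Or.inr (mem_partsUnion_childParts.1 hx)))
    have hset : (RTree.node i cs).nodes.toFinset =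
        insert i (partsUnion (childParts D i cs)) := by
      ext x
      rw [List.mem_toFinset, RTree.mem_nodes_node, Finset.mem_insert, mem_partsUnion_childParts]
    rw [childParts_map_fst, ← hset] at this
    rw [botPass_val]
    exact this

theorem childParts_parts_of_runningIntersection (hV : D.Within V) {i : Fin m}
    {cs : List (RTree (Fin m))} (hn : (RTree.node i cs).nodes.Nodup)
    (hr : RunningIntersection Q (.node i cs)) : Parts V D (Q i) (childParts D i cs) := by
  obtain ⟨h₁, h₂, -⟩ := RTree.nodup_node hn
  exact childParts_parts hn hr fun c hc =>
    bot_represents hV c (h₂ c hc) (hr.child c hc) (Q i) fun x hx =>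
      (hr.separated c hc x hx i (h₁ c hc)).trans Finset.inter_subset_right

/-- Per node, in units of `d * (D.size * e)`: `31` for joining and grouping, `14` for counting the
relation, `2 + 3` for list handling. -/
theorem botPass_cost_le (hV : D.Within V) {d e : ℕ} (he : D.size ≤ 2 ^ e)
    (h₁ : 1 ≤ D.size * e) (hd : 1 ≤ d) (T : RTree (Fin m)) (hn : T.nodes.Nodup)
    (hr : RunningIntersection Q T) (P : Finset (Fin k)) {b : ℕ} (hb : T.maxDegreeAux b ≤ d) :
    (botPass D P T).cost ≤ 50 * (d * (D.size * e)) * T.nodes.length := by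
  induction T using RTree.ind generalizing P b with
  | h i cs ih =>
    have hp := childParts_parts_of_runningIntersection hV hn hr
    have hs : (cs.map fun c => (botPass D (Q i) c).cost).sum ≤
        50 * (d * (D.size * e)) * (cs.map fun c => c.nodes.length).sum :=
      sum_map_le_mul_sum fun c hc => ih c hc ((RTree.nodup_node hn).2.1 c hc) (hr.child c hc)
        (Q i) (RTree.maxDegreeAux_one_le hb c hc)
    have hj := hp.groupBy_joinFrom_cost_le (Q i ∩ P) he h₁
    rw [childParts_map_fst] at hj
    have hl : (childParts D i cs).length = cs.length := List.length_map _
    rw [hl] at hj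
    have hc := countTable_cost_le D i ((D.length_le_size i).trans he)
    have hD := D.length_le_size i
    have hDe := Nat.mul_le_mul_right e hD
    rw [mul_assoc] at hc
    have he₁ : 1 ≤ e := Nat.pos_of_ne_zero fun h => by simp [h] at h₁
    have hn₁ : D.size ≤ D.size * e := Nat.le_mul_of_pos_right _ he₁
    have hlen := RTree.length_add_le_of_maxDegreeAux_le hb
    have hm₁ : (19 * cs.length + 12) * (D.size * e) ≤ 31 * (d * (D.size * e)) := by
      rw [← mul_assoc 31 d]
      exact Nat.mul_le_mul_right _ (by omega)
    have hm₂ : cs.length ≤ d * (D.size * e) :=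
      (le_add_right le_rfl).trans (hlen.trans (Nat.le_mul_of_pos_right _ h₁))
    have hm₃ : D.size * e ≤ d * (D.size * e) := Nat.le_mul_of_pos_left _ hd
    rw [botPass_cost, RTree.length_nodes_node, mul_add, mul_one]
    omega

end BotPass

-- Second pass: topjoins

section TopPass

variable {k m : ℕ} {Dom : Fin k → Type u} [∀ a, LinearOrder (Dom a)] {Q : Query k m}

theorem topPass_label (top : Option (Table Dom)) (B : RTree (BotInfo m Dom)) :
    (topPass Q top B).val.label = ⟨B.label, top⟩ := by
  cases B
  simp only [topPass, Timed.val_step, Timed.val_bind, Timed.val_pure]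
  rfl

theorem topPassList_labels (p : BotInfo m Dom) (top : Option (Table Dom))
    (left : List (Table Dom)) (cs : List (RTree (BotInfo m Dom))) :
    (topPassList Q p top left cs).val.map (fun c => c.label.toBotInfo) =
      cs.map fun c => c.label := by
  induction cs generalizing left with
  | nil => rw [topPassList]; rfl
  | cons c cs ih =>
    simp only [topPassList, Timed.val_step, Timed.val_bind, Timed.val_pure, List.map_cons, ih,
      topPass_label]

theorem topPass_nodes (top : Option (Table Dom)) (B : RTree (BotInfo m Dom)) :
    (topPass Q top B).val.nodes.map (fun v => v.idx) = B.nodes.map BotInfo.idx := by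
  induction B using RTree.ind generalizing top with
  | h v cs ih =>
    simp only [topPass, Timed.val_step, Timed.val_bind, Timed.val_pure, RTree.nodes,
      List.map_cons]
    congr 1
    generalize ([] : List (Table Dom)) = left
    induction cs generalizing left with
    | nil => rw [topPassList]; rfl
    | cons c cs ihl =>
      simp only [topPassList, Timed.val_step, Timed.val_bind, Timed.val_pure, RTree.nodesList,
        List.map_append]
      rw [ih c List.mem_cons_self, ihl fun x hx => ih x (List.mem_cons_of_mem _ hx)]

/-- The input of the second pass at the root of a subtree `T`: the topjoin represents the relations
outside `T`; it is absent only if there are none. -/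
structure TopInput (V : ∀ a, Finset (Dom a)) (D : Database Q Dom) (T : RTree (Fin m))
    (top : Option (Table Dom)) : Prop where
  represents : ∀ t ∈ top.toList, t.Represents V D (Q T.label) (Finset.univ \ T.nodes.toFinset)
  mem_nodes : top = none → ∀ x, x ∈ T.nodes
  separated : ∀ x ∈ T.nodes, ∀ y ∉ T.nodes, Q x ∩ Q y ⊆ Q T.label

/-- The parts around the relation `i` with children `cs`. -/
noncomputable def nodeParts (D : Database Q Dom) (top : Option (Table Dom)) (i : Fin m)
    (cs : List (RTree (Fin m))) : List (Table Dom × Finset (Fin m)) :=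
  top.toList.map (fun t => (t, Finset.univ \ (RTree.node i cs).nodes.toFinset)) ++
    childParts D i cs

/-- The tree after the second pass: at every node, the topjoin and the botjoins of the children
represent all other relations. -/
inductive Ready (V : ∀ a, Finset (Dom a)) (D : Database Q Dom) (d : ℕ) :
    RTree (TopInfo m Dom) → Prop
  | node {v : TopInfo m Dom} {cs : List (RTree (TopInfo m Dom))}
      (ms : List (Table Dom × Finset (Fin m))) :
      ms.map Prod.fst = v.top.toList ++ cs.map (fun c => c.label.bot) →
      Parts V D (Q v.idx) ms → partsUnion ms = Finset.univ.erase v.idx → ms.length ≤ d →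
      (∀ c ∈ cs, Ready V D d c) → Ready V D d (.node v cs)

variable {V : ∀ a, Finset (Dom a)} {D : Database Q Dom}

/-- The topjoin covers the complement of the subtree, so its separation is that of the subtree with
the two sides exchanged. -/
theorem nodeParts_parts (hV : D.Within V) {top : Option (Table Dom)} {i : Fin m}
    {cs : List (RTree (Fin m))} (hn : (RTree.node i cs).nodes.Nodup)
    (hr : RunningIntersection Q (.node i cs)) (ht : TopInput V D (.node i cs) top) :
    Parts V D (Q i) (nodeParts D top i cs) := by
  have hp := childParts_parts_of_runningIntersection hV hn hr
  refine ⟨fun p hp' => ?_, ?_, fun p hp' x hx y hy => ?_⟩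
  · rcases List.mem_append.1 hp' with h | h
    · obtain ⟨t, ht', rfl⟩ := List.mem_map.1 h
      exact ht.represents t ht'
    · exact hp.represents p h
  · refine List.pairwise_append.2 ⟨?_, hp.disjoint, fun p hp' q hq => ?_⟩
    · cases top <;> simp
    · obtain ⟨t, h, rfl⟩ := List.mem_map.1 hp'
      obtain ⟨c, hc, rfl⟩ := List.mem_map.1 hq
      refine Finset.disjoint_left.2 fun x hx hx' => (Finset.mem_sdiff.1 hx).2 ?_
      rw [List.mem_toFinset] at hx' ⊢
      exact RTree.mem_nodes_node.2 (Or.inr ⟨c, hc, hx'⟩)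
  · rcases List.mem_append.1 hp' with h | h
    · obtain ⟨t, h, rfl⟩ := List.mem_map.1 h
      rw [Finset.inter_comm]
      simp only [Finset.mem_sdiff, Finset.mem_univ, true_and, List.mem_toFinset, not_not] at hx hy
      exact ht.separated y hy x hx
    · exact hp.separated p h x hx y hy

theorem TopInput.mem_partsUnion {top : Option (Table Dom)} {T : RTree (Fin m)}
    (ht : TopInput V D T top) {x : Fin m} :
    x ∈ partsUnion (top.toList.map fun t => (t, Finset.univ \ T.nodes.toFinset)) ↔
      x ∉ T.nodes := by
  cases top with
  | none => simp [LSJoin.mem_partsUnion, ht.mem_nodes rfl x]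
  | some t => simp [LSJoin.mem_partsUnion]

theorem partsUnion_nodeParts {top : Option (Table Dom)} {i : Fin m} {cs : List (RTree (Fin m))}
    (hn : (RTree.node i cs).nodes.Nodup) (ht : TopInput V D (.node i cs) top) :
    partsUnion (nodeParts D top i cs) = Finset.univ.erase i := by
  ext x
  rw [nodeParts, mem_partsUnion_append, ht.mem_partsUnion, mem_partsUnion_childParts,
    RTree.mem_nodes_node, Finset.mem_erase]
  have h := (RTree.nodup_node hn).1
  constructor
  · rintro (h' | ⟨c, hc, hx⟩)
    · exact ⟨fun e => h' (Or.inl e), Finset.mem_univ x⟩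
    · exact ⟨fun e => h c hc (e ▸ hx), Finset.mem_univ x⟩
  · rintro ⟨hx, -⟩
    by_cases hex : ∃ c ∈ cs, x ∈ c.nodes
    · exact Or.inr hex
    · exact Or.inl fun hor => hor.elim hx hex

/-- The parts around `i` without that of the child `c`. -/
theorem siblingParts (hV : D.Within V) {top : Option (Table Dom)} {i : Fin m}
    {pre suf : List (RTree (Fin m))} {c : RTree (Fin m)}
    (hn : (RTree.node i (pre ++ c :: suf)).nodes.Nodup)
    (hr : RunningIntersection Q (.node i (pre ++ c :: suf)))
    (ht : TopInput V D (.node i (pre ++ c :: suf)) top) :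
    ∃ ms : List (Table Dom × Finset (Fin m)),
      ms.map Prod.fst = top.toList ++ (childBots D i pre ++ childBots D i suf) ∧
      Parts V D (Q i) ms ∧ insert i (partsUnion ms) = Finset.univ \ c.nodes.toFinset ∧
      i ∉ partsUnion ms ∧ ms.length = top.toList.length + pre.length + suf.length := by
  have hc : c ∈ pre ++ c :: suf := by simp
  obtain ⟨h₁, -, h₃⟩ := RTree.nodup_node hn
  set tops := top.toList.map
    (fun t => (t, Finset.univ \ (RTree.node i (pre ++ c :: suf)).nodes.toFinset)) with htops
  have hmem : ∀ x, x ∈ partsUnion (tops ++ (childParts D i pre ++ childParts D i suf)) ↔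
      x ≠ i ∧ x ∉ c.nodes := by
    intro x
    rw [mem_partsUnion_append, mem_partsUnion_append, htops, ht.mem_partsUnion,
      mem_partsUnion_childParts, mem_partsUnion_childParts, RTree.mem_nodes_node]
    have huniq : ∀ c' ∈ pre ++ suf, x ∈ c'.nodes → x ∉ c.nodes := by
      intro c' hc' hx hx'
      have hperm : (c :: (pre ++ suf)).Pairwise fun c c' => c.nodes.Disjoint c'.nodes :=
        (List.perm_middle.pairwise_iff fun h => h.symm).1 h₃
      exact (List.pairwise_cons.1 hperm).1 c' hc' hx' hx
    constructor
    · rintro (h | ⟨c', hc', hx⟩ | ⟨c', hc', hx⟩)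
      · rw [not_or] at h
        exact ⟨h.1, fun hx => h.2 ⟨c, hc, hx⟩⟩
      · exact ⟨fun e => h₁ c' (by simp [hc']) (e ▸ hx), huniq c' (by simp [hc']) hx⟩
      · exact ⟨fun e => h₁ c' (by simp [hc']) (e ▸ hx), huniq c' (by simp [hc']) hx⟩
    · rintro ⟨hxi, hxc⟩
      by_cases h : ∃ c' ∈ pre ++ c :: suf, x ∈ c'.nodes
      · obtain ⟨c', hc', hx⟩ := h
        rcases List.mem_append.1 hc' with h' | h'
        · exact Or.inr (Or.inl ⟨c', h', hx⟩)
        · rcases List.mem_cons.1 h' with rfl | h'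
          · exact absurd hx hxc
          · exact Or.inr (Or.inr ⟨c', h', hx⟩)
      · exact Or.inl fun h' => h'.elim hxi h
  refine ⟨tops ++ (childParts D i pre ++ childParts D i suf), ?_, ?_, ?_, ?_, ?_⟩
  · rw [List.map_append, List.map_append, childParts_map_fst, childParts_map_fst, htops,
      List.map_map]
    congr 1
    exact List.map_id _
  · refine (nodeParts_parts hV hn hr ht).sublist (List.Sublist.append_left ?_ _)
    rw [childParts, childParts, childParts, ← List.map_append]
    exact List.Sublist.map _ (List.Sublist.append_left (List.sublist_cons_self _ _) _)
  · ext x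
    rw [Finset.mem_insert, hmem, Finset.mem_sdiff, List.mem_toFinset]
    constructor
    · rintro (rfl | h)
      · exact ⟨Finset.mem_univ _, h₁ c hc⟩
      · exact ⟨Finset.mem_univ _, h.2⟩
    · rintro ⟨-, h⟩
      by_cases hx : x = i
      · exact Or.inl hx
      · exact Or.inr ⟨hx, h⟩
  · rw [hmem]
    exact fun h => h.1 rfl
  · simp [htops, childParts, add_assoc]

/-- The topjoin of the child `c` of `i`. -/
noncomputable def childTop (D : Database Q Dom) (top : Option (Table Dom)) (i : Fin m)
    (pre suf : List (RTree (Fin m))) (c : RTree (Fin m)) : Table Dom :=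
  (groupBy (Q c.label ∩ Q i) (joinFrom (countTable D i).val
    (top.toList ++ (childBots D i pre ++ childBots D i suf))).val).val

/-- The relations outside the subtree of `c` are `i` and the parts around `i` other than that of
`c`; `Parts.groupBy_joinFrom` at `i`, relative to the attributes of `c`, combines them. -/
theorem childTop_topInput (hV : D.Within V) {top : Option (Table Dom)} {i : Fin m}
    {pre suf : List (RTree (Fin m))} {c : RTree (Fin m)}
    (hn : (RTree.node i (pre ++ c :: suf)).nodes.Nodup)
    (hr : RunningIntersection Q (.node i (pre ++ c :: suf)))
    (ht : TopInput V D (.node i (pre ++ c :: suf)) top) :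
    TopInput V D c (some (childTop D top i pre suf c)) := by
  have hc : c ∈ pre ++ c :: suf := by simp
  obtain ⟨ms, hms, hp, hu, hi, -⟩ := siblingParts hV hn hr ht
  refine ⟨fun t h => ?_, fun h => by simp at h, fun x hx y hy =>
    (hr.separated c hc x hx y hy).trans Finset.inter_subset_right⟩
  obtain rfl : t = childTop D top i pre suf c := by simpa using h
  have := hp.groupBy_joinFrom hV hi (P := Q c.label) (G := Q c.label ∩ Q i)
    Finset.inter_subset_left (Finset.sdiff_inter_self_right _ _) fun x hx => by
      have hx' : x ∉ c.nodes := by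
        have : x ∈ insert i (partsUnion ms) := Finset.mem_insert_of_mem hx
        rw [hu, Finset.mem_sdiff, List.mem_toFinset] at this
        exact this.2
      rw [Finset.inter_comm]
      exact (hr.separated c hc _ c.label_mem_nodes x hx').trans Finset.inter_subset_left
  rw [hms, hu] at this
  exact this

/-- The loop invariant: the accumulator holds the botjoins of the visited children `pre` in reverse,
and `revAppendT` restores their order. -/
theorem topPassList_cons_val (top : Option (Table Dom)) (i : Fin m) (b : Table Dom)
    (pre suf : List (RTree (Fin m))) (c : RTree (Fin m)) :
    (topPassList Q ⟨i, (countTable D i).val, b⟩ top (childBots D i pre).reverse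
      ((c :: suf).map fun c => (botPass D (Q i) c).val)).val =
    (topPass Q (some (childTop D top i pre suf c)) (botPass D (Q i) c).val).val ::
      (topPassList Q ⟨i, (countTable D i).val, b⟩ top (childBots D i (pre ++ [c])).reverse
        (suf.map fun c => (botPass D (Q i) c).val)).val := by
  have e₁ : (suf.map fun c => (botPass D (Q i) c).val).map (fun c' => c'.label.bot) =
      childBots D i suf := by
    rw [List.map_map]
    rfl
  have e₂ : (botPass D (Q i) c).val.label.bot :: (childBots D i pre).reverse =
      (childBots D i (pre ++ [c])).reverse := by
    simp [childBots]
  simp only [List.map_cons, topPassList, Timed.val_step, Timed.val_bind, Timed.val_pure,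
    mapT_val, revAppendT_val, List.reverse_reverse, botPass_label_idx, e₁, e₂]
  rfl

theorem topPassList_cons_cost (top : Option (Table Dom)) (i : Fin m) (b : Table Dom)
    (pre suf : List (RTree (Fin m))) (c : RTree (Fin m)) :
    (topPassList Q ⟨i, (countTable D i).val, b⟩ top (childBots D i pre).reverse
      ((c :: suf).map fun c => (botPass D (Q i) c).val)).cost =
    pre.length + suf.length + 3 + ((joinFrom (countTable D i).val
        (top.toList ++ (childBots D i pre ++ childBots D i suf))).cost +
      (groupBy (Q c.label ∩ Q i) (joinFrom (countTable D i).val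
        (top.toList ++ (childBots D i pre ++ childBots D i suf))).val).cost) +
    (topPass Q (some (childTop D top i pre suf c)) (botPass D (Q i) c).val).cost +
      (topPassList Q ⟨i, (countTable D i).val, b⟩ top (childBots D i (pre ++ [c])).reverse
        (suf.map fun c => (botPass D (Q i) c).val)).cost := by
  have e₁ : (suf.map fun c => (botPass D (Q i) c).val).map (fun c' => c'.label.bot) =
      childBots D i suf := by
    rw [List.map_map]
    rfl
  have e₂ : (botPass D (Q i) c).val.label.bot :: (childBots D i pre).reverse =
      (childBots D i (pre ++ [c])).reverse := by
    simp [childBots]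
  have e₃ : (childBots D i pre).length = pre.length := List.length_map _
  simp only [List.map_cons, topPassList, Timed.cost_step, Timed.cost_bind, Timed.cost_pure,
    mapT_val, revAppendT_val, List.reverse_reverse, botPass_label_idx, e₁, e₂, mapT_cost,
    revAppendT_cost, List.length_map, List.length_reverse, e₃, childTop]
  omega

/-- After the second pass, the topjoin and the botjoins around each node represent all other
relations. -/
theorem topPass_ready (hV : D.Within V) {d : ℕ} (T : RTree (Fin m)) (hn : T.nodes.Nodup)
    (hr : RunningIntersection Q T) (P : Finset (Fin k)) (top : Option (Table Dom))
    (ht : TopInput V D T top) (hd : T.maxDegreeAux top.toList.length ≤ d) :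
    Ready V D d (topPass Q top (botPass D P T).val).val := by
  induction T using RTree.ind generalizing P top with
  | h i cs ih =>
    have hlab := fun b => topPassList_labels (Q := Q) ⟨i, (countTable D i).val, b⟩ top []
      (cs.map fun c => (botPass D (Q i) c).val)
    rw [botPass_val]
    simp only [topPass, Timed.val_step, Timed.val_bind, Timed.val_pure]
    generalize (groupBy (Q i ∩ P) (joinFrom (countTable D i).val (childBots D i cs)).val).val = b
    refine .node (nodeParts D top i cs) ?_ (nodeParts_parts hV hn hr ht)
      (partsUnion_nodeParts hn ht) ?_ ?_
    · have := congrArg (List.map BotInfo.bot) (hlab b)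
      rw [List.map_map, List.map_map, List.map_map] at this
      rw [nodeParts, List.map_append, childParts_map_fst, List.map_map]
      congr 1
      · exact List.map_id _
      · exact this.symm
    · have := RTree.length_add_le_of_maxDegreeAux_le hd
      simp only [nodeParts, childParts, List.length_append, List.length_map]
      omega
    -- Induction on the unvisited children, with the visited ones kept in `pre`.
    · suffices h : ∀ suf pre, pre ++ suf = cs →
          ∀ c' ∈ (topPassList Q ⟨i, (countTable D i).val, b⟩ top (childBots D i pre).reverse
            (suf.map fun c => (botPass D (Q i) c).val)).val, Ready V D d c' from h cs [] rfl
      intro suf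
      induction suf with
      | nil =>
        intro pre _ c' hc'
        simp [topPassList] at hc'
      | cons c suf ihl =>
        intro pre hcs c' hc'
        rw [topPassList_cons_val] at hc'
        rcases List.mem_cons.1 hc' with rfl | hc'
        · have hc : c ∈ cs := by simp [← hcs]
          refine ih c hc ((RTree.nodup_node hn).2.1 c hc) (hr.child c hc) _ _ ?_
            (RTree.maxDegreeAux_one_le hd c hc)
          subst hcs
          exact childTop_topInput hV hn hr ht
        · exact ihl (pre ++ [c]) (by simp [← hcs]) c' hc'

/-- A topjoin is computed at the parent but charged to the child: of the `40` units of each subtree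
root, `38` are reserved for its own topjoin (at most `31` for join and grouping, the rest for list
handling). -/
theorem topPass_cost_le (hV : D.Within V) {d e : ℕ} (he : D.size ≤ 2 ^ e)
    (h₁ : 1 ≤ D.size * e) (hd₁ : 1 ≤ d) (T : RTree (Fin m)) (hn : T.nodes.Nodup)
    (hr : RunningIntersection Q T) (P : Finset (Fin k)) (top : Option (Table Dom))
    (ht : TopInput V D T top) (hd : T.maxDegreeAux top.toList.length ≤ d) :
    (topPass Q top (botPass D P T).val).cost + 38 * (d * (D.size * e)) ≤
      40 * (d * (D.size * e)) * T.nodes.length := by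
  induction T using RTree.ind generalizing P top with
  | h i cs ih =>
    have hlen := RTree.length_add_le_of_maxDegreeAux_le hd
    have hdn : d ≤ d * (D.size * e) := Nat.le_mul_of_pos_right _ h₁
    rw [botPass_val]
    simp only [topPass, Timed.cost_step, Timed.cost_bind, Timed.cost_pure]
    generalize (groupBy (Q i ∩ P) (joinFrom (countTable D i).val (childBots D i cs)).val).val = b
    have h : ∀ suf pre, pre ++ suf = cs →
        (topPassList Q ⟨i, (countTable D i).val, b⟩ top (childBots D i pre).reverse
          (suf.map fun c => (botPass D (Q i) c).val)).cost ≤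
          40 * (d * (D.size * e)) * (suf.map fun c => c.nodes.length).sum + 1 := by
      intro suf
      induction suf with
      | nil =>
        intro pre _
        simp [topPassList]
      | cons c suf ihl =>
        intro pre hcs
        have hc : c ∈ cs := by simp [← hcs]
        have hsub := ihl (pre ++ [c]) (by simp [← hcs])
        have hlen' : pre.length + suf.length + 1 = cs.length := by
          simp [← hcs, add_assoc]
        subst hcs
        have hchild := ih c hc ((RTree.nodup_node hn).2.1 c hc) (hr.child c hc) (Q i) _
          (childTop_topInput hV hn hr ht) (RTree.maxDegreeAux_one_le hd c hc)
        obtain ⟨ms, hms, hp, -, -, hml⟩ := siblingParts hV hn hr ht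
        have hj := hp.groupBy_joinFrom_cost_le (Q c.label ∩ Q i) he h₁
        rw [hms] at hj
        have hm : (19 * ms.length + 12) * (D.size * e) ≤ 31 * (d * (D.size * e)) := by
          rw [← mul_assoc 31 d]
          exact Nat.mul_le_mul_right _ (by omega)
        rw [topPassList_cons_cost, List.map_cons, List.sum_cons, mul_add]
        omega
    have := h cs [] rfl
    rw [RTree.length_nodes_node, mul_add, mul_one]
    change (topPassList Q ⟨i, (countTable D i).val, b⟩ top (childBots D i []).reverse
          (cs.map fun c => (botPass D (Q i) c).val)).cost + 0 + 1 + _ ≤ _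
    omega

end TopPass

-- Third pass: multiplicity tables

section MultPass

variable {k m : ℕ} {Dom : Fin k → Type u} [∀ a, LinearOrder (Dom a)] {Q : Query k m}

/-- The multiplicity table of a relation represents all other relations. -/
structure IsMultTable (V : ∀ a, Finset (Dom a)) (D : Database Q Dom) (d : ℕ)
    (p : Fin m × Table Dom) : Prop where
  schema_subset : p.2.schema ⊆ Q p.1
  nodup : (p.2.rows.map Prod.fst).Nodup
  weight_eq : p.2.weight = message V Q (relWeight D) (Q p.1) (Finset.univ.erase p.1)
  length_le : 1 ≤ D.size → p.2.rows.length ≤ D.size ^ d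

variable {V : ∀ a, Finset (Dom a)} {D : Database Q Dom} {d : ℕ}

/-- All schemas lie in `Q i`, so grouping sums nothing out and only merges equal rows. The size
bound is a power because the joined tables may have few common attributes. -/
theorem Parts.isMultTable {i : Fin m} {ms : List (Table Dom × Finset (Fin m))}
    (h : Parts V D (Q i) ms) (hu : partsUnion ms = Finset.univ.erase i) (hd : ms.length ≤ d) :
    IsMultTable V D d (i, (groupBy (Q i) (joinAll (ms.map Prod.fst)).val).val) := by
  have hs : (joinAll (ms.map Prod.fst)).val.schema ⊆ Q i := by
    refine joinAll_schema_subset fun R hR => ?_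
    obtain ⟨p, hp, rfl⟩ := List.mem_map.1 hR
    exact (h.represents p hp).schema_subset
  have hw : (joinAll (ms.map Prod.fst)).val.Within V := by
    refine joinAll_within fun R hR => ?_
    obtain ⟨p, hp, rfl⟩ := List.mem_map.1 hR
    exact (h.represents p hp).within
  refine ⟨Finset.inter_subset_left, groupBy_nodup _ _, ?_, fun hn => ?_⟩
  · funext σ
    rw [groupBy_weight (Q i) _ hw, Finset.sdiff_eq_empty_iff_subset.2 hs, marg_empty,
      joinAll_weight, h.prod_weight, hu]
  · refine (groupBy_length_le _ _).trans (joinAll_length_le hn (by simpa using hd) fun R hR => ?_)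
    obtain ⟨p, hp, rfl⟩ := List.mem_map.1 hR
    exact (h.represents p hp).length_le

theorem multPass_map_fst (acc : List (Fin m × Table Dom)) (T : RTree (TopInfo m Dom)) :
    (multPass Q acc T).val.map Prod.fst = T.nodes.map (fun v => v.idx) ++ acc.map Prod.fst := by
  induction T using RTree.ind generalizing acc with
  | h v cs ih =>
    simp only [multPass, Timed.val_step, Timed.val_bind, Timed.val_pure, List.map_cons,
      RTree.nodes, List.cons_append]
    congr 1
    induction cs with
    | nil => simp [multPassList, RTree.nodesList]
    | cons c cs ihl =>
      simp only [multPassList, Timed.val_step, Timed.val_bind, RTree.nodesList, List.map_append,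
        List.append_assoc]
      rw [ih c List.mem_cons_self, ihl fun x hx => ih x (List.mem_cons_of_mem _ hx)]

theorem multPass_isMultTable (acc : List (Fin m × Table Dom)) (T : RTree (TopInfo m Dom))
    (hT : Ready V D d T) (hacc : ∀ p ∈ acc, IsMultTable V D d p) :
    ∀ p ∈ (multPass Q acc T).val, IsMultTable V D d p := by
  induction T using RTree.ind generalizing acc with
  | h v cs ih =>
    obtain ⟨ms, hms, hp, hu, hl, hcs⟩ := hT
    simp only [multPass, Timed.val_step, Timed.val_bind, Timed.val_pure, mapT_val, ← hms]
    refine List.forall_mem_cons.2 ⟨hp.isMultTable hu hl, ?_⟩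
    clear hms
    induction cs with
    | nil => simpa [multPassList] using hacc
    | cons c cs ihl =>
      simp only [multPassList, Timed.val_step, Timed.val_bind]
      exact ih c List.mem_cons_self _ (hcs c List.mem_cons_self)
        (ihl (fun x hx => ih x (List.mem_cons_of_mem _ hx))
          fun x hx => hcs x (List.mem_cons_of_mem _ hx))

/-- Per node, in units of `d * e * D.size ^ d`: `18` for the join, `4 + 3` for grouping, and `2 + 9`
for list handling and additive constants. -/
theorem multPass_cost_le {e : ℕ} (he : D.size ≤ 2 ^ e) (hn : 2 ≤ D.size) (hd : 1 ≤ d)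
    (acc : List (Fin m × Table Dom)) (T : RTree (TopInfo m Dom)) (hT : Ready V D d T) :
    (multPass Q acc T).cost ≤ 36 * (d * e * D.size ^ d) * T.nodes.length := by
  have he₁ : 1 ≤ e := Nat.pos_of_ne_zero fun h => by simp [h] at he; omega
  have hpow : 1 ≤ D.size ^ d := Nat.one_le_pow _ _ (by omega)
  have hX₁ : d ≤ d * e * D.size ^ d := by
    rw [mul_assoc]
    exact Nat.le_mul_of_pos_right _ (Nat.mul_pos he₁ hpow)
  have hX₂ : D.size ^ d ≤ d * e * D.size ^ d := Nat.le_mul_of_pos_left _ (Nat.mul_pos hd he₁)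
  induction T using RTree.ind generalizing acc with
  | h v cs ih =>
    obtain ⟨ms, hms, hp, hu, hl, hcs⟩ := hT
    have hlist : (multPassList Q acc cs).cost ≤
        36 * (d * e * D.size ^ d) * (cs.map fun c => c.nodes.length).sum + cs.length + 1 := by
      clear hms
      induction cs with
      | nil => simp [multPassList]
      | cons c cs ihl =>
        have h₁ := ihl (fun x hx => ih x (List.mem_cons_of_mem _ hx))
          fun x hx => hcs x (List.mem_cons_of_mem _ hx)
        have h₂ := ih c List.mem_cons_self (multPassList Q acc cs).val (hcs c List.mem_cons_self)
        simp only [multPassList, Timed.cost_step, Timed.cost_bind, List.map_cons, List.sum_cons,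
          List.length_cons, mul_add]
        omega
    have hR : ∀ R ∈ ms.map Prod.fst, R.rows.length ≤ D.size := by
      intro R hR
      obtain ⟨p, hp', rfl⟩ := List.mem_map.1 hR
      exact (hp.represents p hp').length_le
    have hml : (ms.map Prod.fst).length ≤ d := by simpa using hl
    have hj := joinAll_cost_le he hn hml hR
    have hjl := joinAll_length_le (by omega : 1 ≤ D.size) hml hR
    have hpe : D.size ^ d ≤ 2 ^ (e * d) := by
      rw [pow_mul]
      exact Nat.pow_le_pow_left he d
    have hg := groupBy_cost_le (Q v.idx) _ (hjl.trans hpe)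
    have hm := Nat.mul_le_mul_right (e * d) hjl
    have hm' : D.size ^ d * (e * d) = d * e * D.size ^ d := by ring
    rw [mul_assoc] at hg
    have hr : cs.length ≤ d := by
      have := congrArg List.length hms
      simp only [List.length_map, List.length_append] at this
      omega
    simp only [multPass, Timed.cost_step, Timed.cost_bind, Timed.cost_pure, mapT_val, mapT_cost,
      ← hms]
    rw [RTree.length_nodes_node, mul_add, mul_one]
    omega

end MultPass

-- Selecting a row with the largest count

section Selection

variable {k m : ℕ} {Dom : Fin k → Type u} [∀ a, Inhabited (Dom a)]
  {Q : Query k m}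

theorem bestRow_sens_le (i : Fin m) {S : Finset (Fin k)} (best : Output Q Dom)
    (l : List (Tuple Dom S × ℕ)) : best.sens ≤ (bestRow i best l).val.sens ∧
      ∀ r ∈ l, r.2 ≤ (bestRow i best l).val.sens := by
  induction l generalizing best with
  | nil => simp [bestRow]
  | cons r l ih =>
    simp only [bestRow, Timed.val_step]
    set b : Output Q Dom := if best.sens < r.2 then ⟨r.2, ⟨i, r.1.extrapolate (Q i)⟩⟩ else best
      with hb
    have h : best.sens ≤ b.sens ∧ r.2 ≤ b.sens := by
      rw [hb]
      split_ifs with h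
      · exact ⟨h.le, le_rfl⟩
      · exact ⟨le_rfl, not_lt.1 h⟩
    exact ⟨h.1.trans (ih b).1, List.forall_mem_cons.2 ⟨h.2.trans (ih b).1, (ih b).2⟩⟩

theorem bestRow_eq (i : Fin m) {S : Finset (Fin k)} (best : Output Q Dom)
    (l : List (Tuple Dom S × ℕ)) : (bestRow i best l).val = best ∨
      ∃ r ∈ l, (bestRow i best l).val = ⟨r.2, ⟨i, r.1.extrapolate (Q i)⟩⟩ := by
  induction l generalizing best with
  | nil => exact Or.inl rfl
  | cons r l ih =>
    simp only [bestRow, Timed.val_step]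
    rcases ih (if best.sens < r.2 then ⟨r.2, ⟨i, r.1.extrapolate (Q i)⟩⟩ else best) with h | h
    · rw [h]
      split_ifs
      · exact Or.inr ⟨r, List.mem_cons_self, rfl⟩
      · exact Or.inl rfl
    · obtain ⟨s, hs, h⟩ := h
      exact Or.inr ⟨s, List.mem_cons_of_mem _ hs, h⟩

theorem bestRow_cost (i : Fin m) {S : Finset (Fin k)} (best : Output Q Dom)
    (l : List (Tuple Dom S × ℕ)) : (bestRow i best l).cost = l.length + 1 := by
  induction l generalizing best with
  | nil => rfl
  | cons r l ih => simp only [bestRow, Timed.cost_step, ih, List.length_cons]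

theorem bestTable_sens_le (best : Output Q Dom) (l : List (Fin m × Table Dom)) :
    best.sens ≤ (bestTable best l).val.sens ∧
      ∀ p ∈ l, ∀ r ∈ p.2.rows, r.2 ≤ (bestTable best l).val.sens := by
  induction l generalizing best with
  | nil => simp [bestTable]
  | cons p l ih =>
    simp only [bestTable, Timed.val_step, Timed.val_bind]
    have h := bestRow_sens_le p.1 best p.2.rows
    have h' := ih (bestRow p.1 best p.2.rows).val
    exact ⟨h.1.trans h'.1, List.forall_mem_cons.2 ⟨fun r hr => (h.2 r hr).trans h'.1, h'.2⟩⟩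

theorem bestTable_eq (best : Output Q Dom) (l : List (Fin m × Table Dom)) :
    (bestTable best l).val = best ∨ ∃ p ∈ l, ∃ r ∈ p.2.rows,
      (bestTable best l).val = ⟨r.2, ⟨p.1, r.1.extrapolate (Q p.1)⟩⟩ := by
  induction l generalizing best with
  | nil => exact Or.inl rfl
  | cons p l ih =>
    simp only [bestTable, Timed.val_step, Timed.val_bind]
    rcases ih (bestRow p.1 best p.2.rows).val with h | ⟨q, hq, h⟩
    · rw [h]
      exact (bestRow_eq p.1 best p.2.rows).imp_right fun h => ⟨p, List.mem_cons_self, h⟩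
    · exact Or.inr ⟨q, List.mem_cons_of_mem _ hq, h⟩

theorem bestTable_cost_le (best : Output Q Dom) (l : List (Fin m × Table Dom)) {N : ℕ}
    (h : ∀ p ∈ l, p.2.rows.length ≤ N) : (bestTable best l).cost ≤ l.length * (N + 2) + 1 := by
  induction l generalizing best with
  | nil => simp [bestTable]
  | cons p l ih =>
    have h₁ := h p List.mem_cons_self
    have h₂ := ih (bestRow p.1 best p.2.rows).val fun q hq => h q (List.mem_cons_of_mem _ hq)
    simp only [bestTable, Timed.cost_step, Timed.cost_bind, bestRow_cost, List.length_cons,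
      add_mul, one_mul]
    omega

end Selection

-- Correctness and running time of the algorithm

section Main

variable {k m : ℕ} {Dom : Fin k → Type u} {Q : Query k m}

theorem IsJoinTree.one_le_maxDegree {T : RTree (Fin m)} (hT : IsJoinTree Q T) (hm : 2 ≤ m) :
    1 ≤ T.maxDegree := by
  have hl := hT.nodes_perm.length_eq
  rw [List.length_finRange] at hl
  obtain ⟨i, cs⟩ := T
  cases cs with
  | nil =>
    simp [RTree.nodes, RTree.nodesList] at hl
    omega
  | cons c cs =>
    have := RTree.length_add_le_of_maxDegreeAux_le (le_refl (RTree.node i (c :: cs)).maxDegree)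
    rw [List.length_cons] at this
    omega

variable [∀ a, LinearOrder (Dom a)]

theorem IsJoinTree.mem_nodes {T : RTree (Fin m)} (hT : IsJoinTree Q T) (x : Fin m) :
    x ∈ T.nodes := hT.nodes_perm.mem_iff.2 (List.mem_finRange x)

theorem IsJoinTree.topInput {T : RTree (Fin m)} (hT : IsJoinTree Q T)
    (V : ∀ a, Finset (Dom a)) (D : Database Q Dom) : TopInput V D T none where
  represents t ht := by simp at ht
  mem_nodes _ := hT.mem_nodes
  separated _ _ y hy := absurd (hT.mem_nodes y) hy

/-- The multiplicity tables computed on a join tree. -/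
noncomputable def multTables (T : RTree (Fin m)) (D : Database Q Dom) :
    List (Fin m × Table Dom) :=
  (multPass Q [] (topPass Q none (botPass D (Q T.label) T).val).val).val

theorem multTables_map_fst (T : RTree (Fin m)) (D : Database Q Dom) :
    (multTables T D).map Prod.fst = T.nodes := by
  rw [multTables, multPass_map_fst, topPass_nodes, botPass_nodes, List.map_nil, List.append_nil]

variable [∀ a, Inhabited (Dom a)]

/-- The values that occur in the database, for each attribute. -/
noncomputable def activeDomain (D : Database Q Dom) (a : Fin k) : Finset (Dom a) :=
  Finset.univ.biUnion fun j => (D j).toFinset.image fun t => t.extend a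

theorem within_activeDomain (D : Database Q Dom) : D.Within (activeDomain D) := by
  intro j t ht a
  refine Finset.mem_biUnion.2 ⟨j, Finset.mem_univ j, Finset.mem_image.2
    ⟨t, List.mem_toFinset.2 ht, ?_⟩⟩
  simp [Tuple.extend]

/-- Both sides are the message of all relations other than `p.1`, relative to its attributes. -/
theorem tupleSens_eq_weight {V : ∀ a, Finset (Dom a)} {D : Database Q Dom} (hV : D.Within V)
    {d : ℕ} {p : Fin m × Table Dom} (hp : IsMultTable V D d p) (t : Tuple Dom (Q p.1)) :
    tupleSens D.toInstance ⟨p.1, t⟩ = p.2.weight t.extend := by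
  rw [tupleSens_eq_message D.toInstance (V := V) (fun j t ht a => hV j t ht a), hp.weight_eq]
  congr 1
  funext j σ
  exact Multiset.coe_count _ _

theorem IsJoinTree.isMultTable {T : RTree (Fin m)} (hT : IsJoinTree Q T) (D : Database Q Dom) :
    ∀ p ∈ multTables T D, IsMultTable (activeDomain D) D T.maxDegree p :=
  multPass_isMultTable _ _ (topPass_ready (within_activeDomain D) T hT.nodup
    hT.runningIntersection _ none (hT.topInput _ D) le_rfl) (by simp)

/-- A tuple of positive sensitivity must match a row of its multiplicity table, and the selection
saw that row. -/
theorem tupleSens_le (T : RTree (Fin m)) (hT : IsJoinTree Q T) (D : Database Q Dom)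
    (t : Σ i, Tuple Dom (Q i)) :
    tupleSens D.toInstance t ≤ (lsAcyclicJoin Q T D).val.sens := by
  obtain ⟨i, t⟩ := t
  have hi : i ∈ (multTables T D).map Prod.fst := by
    rw [multTables_map_fst]
    exact hT.mem_nodes i
  obtain ⟨p, hp, rfl⟩ := List.mem_map.1 hi
  have hM := hT.isMultTable D p hp
  rw [tupleSens_eq_weight (within_activeDomain D) hM]
  by_cases h0 : p.2.weight t.extend = 0
  · rw [h0]
    exact Nat.zero_le _
  · obtain ⟨r, hr, hrt⟩ := p.2.exists_mem_of_weight_ne_zero h0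
    rw [p.2.weight_eq_of_mem hM.nodup hr hrt]
    exact (bestTable_sens_le _ (multTables T D)).2 p hp r hr

theorem tupleSens_output (T : RTree (Fin m)) (hT : IsJoinTree Q T) (D : Database Q Dom) :
    tupleSens D.toInstance (lsAcyclicJoin Q T D).val.tuple =
      (lsAcyclicJoin Q T D).val.sens := by
  have hle := tupleSens_le T hT D (lsAcyclicJoin Q T D).val.tuple
  have hval : (lsAcyclicJoin Q T D).val =
      (bestTable ⟨0, ⟨T.label, fun _ => default⟩⟩ (multTables T D)).val := rfl
  rcases bestTable_eq (Q := Q) ⟨0, ⟨T.label, fun _ => default⟩⟩ (multTables T D) with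
    h | ⟨p, hp, r, hr, h⟩
  · rw [hval, h] at hle ⊢
    -- The initial output with count `0` was kept; the upper bound then forces its arbitrary tuple
    -- to have sensitivity `0`.
    exact Nat.le_zero.1 hle
  · have hM := hT.isMultTable D p hp
    rw [hval, h, tupleSens_eq_weight (within_activeDomain D) hM]
    -- Default values are filled in only outside the schema, where the weight does not look.
    refine p.2.weight_eq_of_mem hM.nodup hr (onAttrs_eq_iff.2 fun a ha => ?_)
    simp [Tuple.extend, Tuple.extrapolate, hM.schema_subset ha, ha]

theorem lsAcyclicJoin_cost_le {T : RTree (Fin m)} (hT : IsJoinTree Q T) (D : Database Q Dom)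
    (hm : 2 ≤ m) (hn : 2 ≤ D.size) {e : ℕ} (he : D.size ≤ 2 ^ e) :
    (lsAcyclicJoin Q T D).cost ≤ 131 * (T.maxDegree * e * D.size ^ T.maxDegree) * m := by
  have hd := hT.one_le_maxDegree hm
  have hV := within_activeDomain D
  have hlen : T.nodes.length = m := by
    rw [hT.nodes_perm.length_eq, List.length_finRange]
  have hB : (topPass Q none (botPass D (Q T.label) T).val).val.nodes.length = m := by
    have h := congrArg List.length
      (topPass_nodes (Q := Q) none (botPass D (Q T.label) T).val)
    rw [botPass_nodes, List.length_map] at h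
    exact h.trans hlen
  have hready := topPass_ready hV T hT.nodup hT.runningIntersection (Q T.label) none
    (hT.topInput _ D) (le_refl T.maxDegree)
  set d := T.maxDegree with hdef
  have he₁ : 1 ≤ e := Nat.pos_of_ne_zero fun h => by simp [h] at he; omega
  have h₁ : 1 ≤ D.size * e := Nat.mul_pos (by omega) he₁
  have hX₁ : d * (D.size * e) ≤ d * e * D.size ^ d := by
    calc d * (D.size * e) = d * e * D.size := by ring
      _ ≤ _ := Nat.mul_le_mul_left _ (Nat.le_self_pow (by omega) _)
  have hX₂ : D.size ^ d ≤ d * e * D.size ^ d := Nat.le_mul_of_pos_left _ (Nat.mul_pos hd he₁)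
  have hX₃ : 1 ≤ d * e * D.size ^ d :=
    Nat.mul_pos (Nat.mul_pos hd he₁) (Nat.pow_pos (by omega))
  have hbot := botPass_cost_le hV he h₁ hd T hT.nodup hT.runningIntersection (Q T.label)
    (b := 0) (le_refl T.maxDegree)
  have htop := topPass_cost_le hV he h₁ hd T hT.nodup hT.runningIntersection (Q T.label) none
    (hT.topInput _ D) (le_refl T.maxDegree)
  have hmult := multPass_cost_le he hn hd [] _ hready
  have hbest := bestTable_cost_le (Q := Q) ⟨0, ⟨T.label, fun _ => default⟩⟩ (multTables T D)
    (N := D.size ^ d) fun p hp => (hT.isMultTable D p hp).length_le (by omega)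
  have htl : (multTables T D).length = m := by
    have h := congrArg List.length (multTables_map_fst T D)
    rw [List.length_map] at h
    exact h.trans hlen
  have hcost : (lsAcyclicJoin Q T D).cost = (botPass D (Q T.label) T).cost +
      ((topPass Q none (botPass D (Q T.label) T).val).cost +
      ((multPass Q [] (topPass Q none (botPass D (Q T.label) T).val).val).cost +
      (bestTable (Q := Q) ⟨0, ⟨T.label, fun _ => default⟩⟩ (multTables T D)).cost)) + 1 := rfl
  rw [hlen] at hbot htop
  rw [hB] at hmult
  rw [htl] at hbest
  have b₁ := Nat.mul_le_mul_right m (Nat.mul_le_mul_left 50 hX₁)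
  have b₂ := Nat.mul_le_mul_right m (Nat.mul_le_mul_left 40 hX₁)
  have b₃ : m * (D.size ^ d + 2) ≤ 3 * (d * e * D.size ^ d) * m := by
    rw [mul_comm]
    exact Nat.mul_le_mul_right m (by omega)
  have b₄ : 2 ≤ 2 * (d * e * D.size ^ d) * m := by
    have := Nat.mul_pos hX₃ (by omega : 0 < m)
    rw [mul_assoc]
    omega
  -- The three passes, the selection, and two leftover single steps.
  have hsum : 131 * (d * e * D.size ^ d) * m = 50 * (d * e * D.size ^ d) * m +
      40 * (d * e * D.size ^ d) * m + 36 * (d * e * D.size ^ d) * m +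
      3 * (d * e * D.size ^ d) * m + 2 * (d * e * D.size ^ d) * m := by ring
  rw [hcost, hsum]
  omega

/-- With `L = Nat.log 2 n ≥ 1`, one has `L + 1 ≤ 2 * L` and `L * log 2 ≤ log n`; the factor `3`
works since `log 2 > 2 / 3`. -/
theorem natLog_add_one_le {n : ℕ} (hn : 2 ≤ n) :
    ((Nat.log 2 n + 1 : ℕ) : ℝ) ≤ 3 * Real.log n := by
  have h₁ : (1 : ℕ) ≤ Nat.log 2 n := Nat.log_pos (by norm_num) hn
  have h₂ : ((2 ^ Nat.log 2 n : ℕ) : ℝ) ≤ n := by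
    exact_mod_cast Nat.pow_log_le_self 2 (by omega : n ≠ 0)
  have h₃ : (Nat.log 2 n : ℝ) * Real.log 2 ≤ Real.log n := by
    rw [← Real.log_pow]
    refine Real.log_le_log (by positivity) ?_
    exact_mod_cast h₂
  have h₄ := Real.log_two_gt_d9
  have h₅ : (1 : ℝ) ≤ Nat.log 2 n := by exact_mod_cast h₁
  push_cast
  nlinarith

end Main

end LSJoin

theorem mainTheorem2 :
    ∃ C : ℝ, ∀ (k m : ℕ) (Dom : Fin k → Type u) [∀ a, LinearOrder (Dom a)]
      [∀ a, Inhabited (Dom a)] (Q : LSJoin.Query k m), 0 < m →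
      (Q.IsAcyclic → ∃ T : LSJoin.RTree (Fin m), LSJoin.GYOTree Q Finset.univ T) ∧
      (∀ T : LSJoin.RTree (Fin m), LSJoin.GYOTree Q Finset.univ T → LSJoin.IsJoinTree Q T) ∧
      ∀ T : LSJoin.RTree (Fin m), LSJoin.IsJoinTree Q T →
        ∀ D : LSJoin.Database Q Dom,
          LSJoin.IsLocalSensitivity D.toInstance (LSJoin.lsAcyclicJoin Q T D).val.sens ∧
          LSJoin.tupleSens D.toInstance (LSJoin.lsAcyclicJoin Q T D).val.tuple =
            (LSJoin.lsAcyclicJoin Q T D).val.sens ∧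
          (2 ≤ m → 2 ≤ D.size →
            ((LSJoin.lsAcyclicJoin Q T D).cost : ℝ) ≤
              C * m * T.maxDegree * (D.size : ℝ) ^ T.maxDegree * Real.log D.size) := by
  refine ⟨393, fun k m Dom _ _ Q hm => ⟨fun h => ?_, fun T hT => hT.isJoinTree, fun T hT D =>
    ⟨⟨⟨_, LSJoin.tupleSens_output T hT D⟩, ?_⟩, LSJoin.tupleSens_output T hT D,
      fun hm₂ hn => ?_⟩⟩⟩
  · exact LSJoin.GYOReduces.exists_gyoTree h ⟨⟨0, hm⟩, Finset.mem_univ _⟩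
  · rintro _ ⟨t, rfl⟩
    exact LSJoin.tupleSens_le T hT D t
  -- The exponent is `Nat.log 2 D.size + 1`, which costs the factor `3` in `393 = 131 * 3`.
  · have hc := LSJoin.lsAcyclicJoin_cost_le hT D hm₂ hn
      (Nat.lt_pow_succ_log_self (by norm_num) D.size).le
    have hl := LSJoin.natLog_add_one_le hn
    calc ((LSJoin.lsAcyclicJoin Q T D).cost : ℝ)
        ≤ ((131 * (T.maxDegree * (Nat.log 2 D.size + 1) * D.size ^ T.maxDegree) * m : ℕ) : ℝ) := by
          exact_mod_cast hc
      _ = 131 * m * T.maxDegree * (D.size : ℝ) ^ T.maxDegree *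
            ((Nat.log 2 D.size + 1 : ℕ) : ℝ) := by
          push_cast
          ring
      _ ≤ 131 * m * T.maxDegree * (D.size : ℝ) ^ T.maxDegree * (3 * Real.log D.size) := by
          gcongr
      _ = 393 * m * T.maxDegree * (D.size : ℝ) ^ T.maxDegree * Real.log D.size := by ring
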